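/- **Setting.** Let $G(2m,m)$ be the set of $m$-dimensional subspaces of $\mathbb F_2^{2m}$, and for $W\in G(2m,m)$ let $W^\perp=\{z: x\cdot z=0\ \forall x\in W\}$. Let $CS(W)$, $CS(W^\perp)$ be sets of coset representatives of $W$ and of $W^\perp$ in $\mathbb F_2^{2m}$, and let $$|W_{x,z}\rangle = 2^{-m/2}\sum_{u\in W}(-1)^{z\cdot u}|x+u\rangle\in(\mathbb C^2)^{\otimes 2m}.$$ In the coset guessing game, $W\in G(2m,m)$, $x\in CS(W)$, $z\in CS(W^\perp)$ are uniformly random; Bob gets the first $m$ qubits of $|W_{x,z}\rangle$, Charlie gets the last $m$, and both are told $W$. A strategy consists, for each $W$, of a POVM $\{B_x^W\}_{x\in CS(W)}$ on Bob's qubits and a POVM $\{C_z^W\}_{z\in CS(W^\perp)}$ on Charlie's qubits. Its winning probability is the average of $\operatorname{Tr}[(B_x^W\otimes C_z^W)|W_{x,z}\rangle\langle W_{x,z}|]$ over $W,x,z$. Let $\binom{n}{k}_2=\prod_{j=0}^{k-1}\frac{2^{n-j}-1}{2^{k-j}-1}$. **Theorem.** For every $m$ and every choice of coset representatives, the maximum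 of the winning probability over all strategies exists and equals $$p_m=\frac{1}{\binom{2m}{m}_2}\sum_{k=0}^m 2^{k^2}\binom mk_2^2\,2^{-k},\qquad\text{and}\qquad p_m=\Theta(2^{-m}).$$ Moreover, the following explicit strategy attains it. For $W\in G(2m,m)$ let $I\subseteq\{1,\dots,2m\}$ be the set of pivot columns of the generator matrix of $W$ in reduced row echelon form, and $I^c$ its complement. Then $CS(W)=\langle e_i\rangle_{i\in I^c}$ and $CS(W^\perp)=\langle e_i\rangle_{i\in I}$ are sets of coset representatives, and these are used. 1. There are circuits of Hadamard and CNOT gates, one on Bob's $m$ qubits and one on Charlie's, pairwise distinct indices $i_1,\dots,i_\ell\in I\cap\{1,\dots,m\}$ and $j_1,\dots,j_\ell\in I^c\cap\{m+1,\dots,2m\}$, and group automorphisms $f_1$ (of the first $m$ coordinates) and $f_2$ (of the last $m$), such that $f=(f_1,f_2)$ maps $CS(W)$ and $CS(W^\perp)$ to themselves, $f_1$ fixes the first half of every $x\in CS(W)$, $f_2$ fixes the second half of every $z\in CS(W^\perp)$, and for all $x\in CS(W)$, $z\in CS(W^\perp)$ the two circuits together map $|W_{x,z}\rangle$ to $$\mathrm{CNOT}_{i_1,j_1}H_{i_1}\cdots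 \mathrm{CNOT}_{i_\ell,j_\ell}H_{i_\ell}\,|f(x+z)\rangle,$$ i.e. to $\ell$ Bell pairs shared by Bob and Charlie and computational basis qubits. 2. For every such reduction there is a bijection $h_W:(I\cap\{1,\dots,m\})\setminus\{i_1,\dots,i_\ell\}\to(I^c\cap\{m+1,\dots,2m\})\setminus\{j_1,\dots,j_\ell\}$. 3. For any such reductions and bijections (one for each $W$), let Bob and Charlie first apply their circuits and then measure with $\bigotimes_{i=1}^m B_i$ for the guess $x$, and $\bigotimes_{j=m+1}^{2m}C_j$ for the guess $z$, where, with $y_B=f(x)$, $y_C=f(z)$ and $|{\pm i}\rangle=(|0\rangle\pm i|1\rangle)/\sqrt2$: $B_i$ is the projection onto $|(y_B)_i\rangle$ if $i\in I^c$; onto $|(y_B)_{h_W(i)}\rangle$ if $i\in I\setminus\{i_1,\dots,i_\ell\}$; and, for $i=i_t$, onto $|{+i}\rangle$ if $(y_B)_{j_t}=0$ and onto $|{-i}\rangle$ if $(y_B)_{j_t}=1$. Likewise $C_j$ is the projection onto $|(y_C)_j\rangle$ if $j\in I$; onto $|(y_C)_{h_W^{-1}(j)}\rangle$ if $j\in I^c\setminus\{j_1,\dots,j_\ell\}$;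 and, for $j=j_t$, onto $|{+i}\rangle$ if $(y_C)_{i_t}=1$ and onto $|{-i}\rangle$ if $(y_C)_{i_t}=0$. These are POVMs; for each $W$ the strategy wins with probability exactly $2^{-k}$, where $k$ is the dimension of the restriction $\{(v_1,\dots,v_m):v\in W\}$ of $W$ to the first $m$ coordinates; and its winning probability is $p_m$. -/

import Mathlib

open scoped Matrix Kronecker ComplexOrder

namespace CosetGame

noncomputable section

/-! ### Binary vectors, subspaces, cosets -/

/-- Bit strings of length `n`, i.e. the vectors of `𝔽₂ⁿ`. -/
abbrev Bits (n : ℕ) : Type := Fin n → ZMod 2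

/-- `G(2m, m)`: the `m`-dimensional subspaces of `𝔽₂²ᵐ`. The coordinates are indexed by `Fin (m + m)`:
`Fin.castAdd m i` is the `i`-th coordinate of Bob's half (the first `m`), and
`Fin.natAdd m j` the `j`-th coordinate of Charlie's half (the last `m`). -/
abbrev Grass (m : ℕ) : Type :=
  {W : Submodule (ZMod 2) (Bits (m + m)) // Module.finrank (ZMod 2) W = m}

instance (m : ℕ) : Fintype (Grass m) :=
  @Fintype.ofFinite _ (Subtype.finite (α := Submodule (ZMod 2) (Bits (m + m))))

/-- The first `m` coordinates (Bob's half). -/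
def bobPart {m : ℕ} (v : Bits (m + m)) : Bits m := fun i => v (Fin.castAdd m i)

/-- The last `m` coordinates (Charlie's half). -/
def charliePart {m : ℕ} (v : Bits (m + m)) : Bits m := fun j => v (Fin.natAdd m j)

/-- `W^⊥ = {z | x · z = 0 for all x ∈ W}`. -/
def perp {n : ℕ} (W : Submodule (ZMod 2) (Bits n)) : Submodule (ZMod 2) (Bits n) where
  carrier := {z | ∀ x ∈ W, x ⬝ᵥ z = 0}
  zero_mem' := fun x _ => dotProduct_zero x
  add_mem' := fun {a b} ha hb x hx => by rw [dotProduct_add, ha x hx, hb x hx, add_zero]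
  smul_mem' := fun c a ha x hx => by rw [dotProduct_smul, ha x hx, smul_zero]

/-- `S` contains exactly one element of every coset of `U`. -/
def IsCosetReps {n : ℕ} (U : Submodule (ZMod 2) (Bits n)) (S : Finset (Bits n)) : Prop :=
  ∀ v : Bits n, ∃! s, s ∈ S ∧ v - s ∈ U

/-- The dimension of the restriction `{v₁ᵐ : v ∈ W}` of `W` to the first `m` coordinates. -/
def bobDim {m : ℕ} (W : Grass m) : ℕ :=
  Module.finrank (ZMod 2)
    (W.1.map (LinearMap.funLeft (ZMod 2) (ZMod 2) (Fin.castAdd m : Fin m → Fin (m + m))))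

/-! ### Qubits: states, operators, measurements

A register of `n` qubits has the state space `Bits n → ℂ` (amplitudes in the computational basis), and
its operators are the complex matrices indexed by `Bits n`. A single qubit is `ZMod 2 → ℂ`. -/

/-- Operators on `n` qubits. -/
abbrev Op (n : ℕ) : Type := Matrix (Bits n) (Bits n) ℂ

/-- The computational basis vector `|v⟩`. -/
def ket {n : ℕ} (v : Bits n) : Bits n → ℂ := Pi.single v 1

/-- `|ψ⟩⟨ψ|`. -/
def proj {α : Type} (ψ : α → ℂ) : Matrix α α ℂ := Matrix.vecMulVec ψ (star ψ)

/-- `(-1)^b`. -/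
def sgn (b : ZMod 2) : ℂ := (-1) ^ b.val

open Classical in
/-- The coset state `|W_{x,z}⟩ = 2^{-m/2} ∑_{u ∈ W} (-1)^{z·u} |x+u⟩`. -/
def cosetState {m : ℕ} (W : Grass m) (x z : Bits (m + m)) : Bits (m + m) → ℂ :=
  ((1 / Real.sqrt (2 ^ m) : ℝ) : ℂ) • ∑ u with u ∈ W.1, sgn (z ⬝ᵥ u) • ket (x + u)

/-- `B ⊗ C`, with `B` acting on the first `m` qubits and `C` on the last `m` qubits. -/
def localOp {m : ℕ} (B C : Op m) : Op (m + m) :=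
  (B ⊗ₖ C).submatrix (fun v => (bobPart v, charliePart v)) (fun v => (bobPart v, charliePart v))

/-- `(E x)_{x ∈ S}` is a positive operator valued measure on `n` qubits. -/
def IsPOVM {X : Type} {n : ℕ} (S : Finset X) (E : X → Op n) : Prop :=
  (∀ x ∈ S, (E x).PosSemidef) ∧ ∑ x ∈ S, E x = 1

/-! ### The coset guessing game -/

/-- For every `W` a finite set of vectors (used for a choice of coset representatives). -/
abbrev RepFamily (m : ℕ) : Type := Grass m → Finset (Bits (m + m))

/-- `S W = CS(W)` and `T W = CS(W^⊥)` are sets of coset representatives of `W` and of `W^⊥`. -/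
def AreRepFamilies {m : ℕ} (S T : RepFamily m) : Prop :=
  ∀ W, IsCosetReps W.1 (S W) ∧ IsCosetReps (perp W.1) (T W)

/-- Operators assigned to every `W` and every possible answer. -/
abbrev Answers (m : ℕ) : Type := Grass m → Bits (m + m) → Op m

/-- A strategy: for every `W`, a POVM `(B W x)_{x ∈ CS(W)}` for Bob on the first `m` qubits and a
POVM `(C W z)_{z ∈ CS(W^⊥)}` for Charlie on the last `m` qubits. -/
def IsStrategy {m : ℕ} (S T : RepFamily m) (B C : Answers m) : Prop :=
  ∀ W, IsPOVM (S W) (B W) ∧ IsPOVM (T W) (C W)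

/-- The probability of winning for given `W`, `x`, `z`:
`Tr[(B_x^W ⊗ C_z^W) |W_{x,z}⟩⟨W_{x,z}|]`. -/
def winProbXZ {m : ℕ} (B C : Answers m) (W : Grass m) (x z : Bits (m + m)) : ℝ :=
  (Matrix.trace (localOp (B W x) (C W z) * proj (cosetState W x z))).re

/-- The probability of winning given `W`: average over uniform `x ∈ CS(W)`, `z ∈ CS(W^⊥)`. -/
def winProbAt {m : ℕ} (S T : RepFamily m) (B C : Answers m) (W : Grass m) : ℝ :=
  (∑ x ∈ S W, ∑ z ∈ T W, winProbXZ B C W x z) / ((S W).card * (T W).card)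

/-- The winning probability: average over uniform `W ∈ G(2m, m)` as well. -/
def winProb {m : ℕ} (S T : RepFamily m) (B C : Answers m) : ℝ :=
  (∑ W : Grass m, winProbAt S T B C W) / Fintype.card (Grass m)

/-- The `q`-binomial coefficient (used for `k ≤ n`). -/
def qBinom (q : ℝ) (n k : ℕ) : ℝ :=
  ∏ j ∈ Finset.range k, (q ^ (n - j) - 1) / (q ^ (k - j) - 1)

/-- `(1 / [2m choose m]₂) ∑_{k=0}^m 2^{k²} [m choose k]₂² (1/2)^k`. -/
def optimalValue (m : ℕ) : ℝ :=
  1 / qBinom 2 (2 * m) m *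
    ∑ k ∈ Finset.range (m + 1), 2 ^ (k ^ 2) * qBinom 2 m k ^ 2 * (1 / 2) ^ k

/-! ### Pivots and the resulting coset representatives -/

/-- The set `I` of pivot columns of the reduced row echelon generator matrix of `W`. These are the
positions of the first nonzero entries of vectors of `W`; see `pivots_eq` below. -/
def pivots {n : ℕ} (W : Submodule (ZMod 2) (Bits n)) : Set (Fin n) :=
  {i | ∃ w ∈ W, w i ≠ 0 ∧ ∀ j < i, w j = 0}

/-- For any generator matrix in reduced row echelon form, `pivots` is the set of its pivot columns. -/
theorem pivots_eq {n d : ℕ} (W : Submodule (ZMod 2) (Bits n)) (A : Matrix (Fin d) (Fin n) (ZMod 2))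
    (hA : A.IsReducedRowEchelon) (hW : Submodule.span (ZMod 2) (Set.range A.row) = W) :
    pivots W = {c | ∃ r, A.IsLeadingEntry r c} := by
  ext c
  constructor
  · rintro ⟨w, hw, hwc, hlt⟩
    rw [← hW, Submodule.mem_span_range_iff_exists_fun] at hw
    obtain ⟨a, rfl⟩ := hw
    simp only [Finset.sum_apply, Pi.smul_apply, smul_eq_mul, Matrix.row_apply] at hwc hlt
    have key : ∀ r c', A.IsLeadingEntry r c' → ∑ s, a s * A s c' = a r := by
      intro r c' h
      rw [Finset.sum_eq_single r, hA.eq_one h, mul_one]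
      · intro s _ hs
        rw [hA.eq_zero_of_ne_of_isLeadingEntry hs h, mul_zero]
      · simp
    by_contra hno
    apply hwc
    apply Finset.sum_eq_zero
    intro r _
    by_cases hr : A r = 0
    · rw [congrFun hr c]; simp
    · obtain ⟨c', hc'⟩ := Matrix.row_ne_zero_iff_exists_isLeadingEntry.mp hr
      rcases lt_trichotomy c c' with h | h | h
      · rw [hc'.1 c h, mul_zero]
      · exact absurd ⟨r, h ▸ hc'⟩ hno
      · rw [← key r c' hc', hlt c' h, zero_mul]
  · rintro ⟨r, h⟩
    exact ⟨A r, hW ▸ Submodule.subset_span ⟨r, rfl⟩, h.2, h.1⟩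

open Classical in
/-- `CS(W) = ⟨e_i⟩_{i ∉ I}`. -/
def canonRep (m : ℕ) : RepFamily m :=
  fun W => Finset.univ.filter fun x => ∀ i ∈ pivots W.1, x i = 0

open Classical in
/-- `CS(W^⊥) = ⟨e_i⟩_{i ∈ I}`. -/
def canonRepPerp (m : ℕ) : RepFamily m :=
  fun W => Finset.univ.filter fun z => ∀ i ∉ pivots W.1, z i = 0

/-! ### Hadamard and CNOT circuits -/

/-- The Hadamard gate on qubit `i`. -/
def hadamard {n : ℕ} (i : Fin n) : Op n := Matrix.of fun v w =>
  if ∀ k, k ≠ i → v k = w k then ((1 / Real.sqrt 2 : ℝ) : ℂ) * sgn (v i * w i) else 0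

/-- The CNOT gate with control `c` and target `t`: it maps `|w⟩` to `|w + w_c e_t⟩`. -/
def cnot {n : ℕ} (c t : Fin n) : Op n := Matrix.of fun v w =>
  if v = Function.update w t (w t + w c) then 1 else 0

/-- A Hadamard gate, or a CNOT gate on two different qubits, of an `n` qubit register. -/
inductive Gate (n : ℕ) : Type
  | H (i : Fin n) : Gate n
  | CNOT (c t : Fin n) (h : c ≠ t) : Gate n

/-- The unitary of a gate. -/
def Gate.op {n : ℕ} : Gate n → Op n
  | .H i => hadamard i
  | .CNOT c t _ => cnot c t

/-- The unitary of a circuit (the last gate of the list is applied first). -/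
def circuitOp {n : ℕ} (L : List (Gate n)) : Op n := (L.map Gate.op).prod

/-! ### Reduction to Bell pairs and computational basis qubits -/

/-- The map `(f₁, f₂)` on `𝔽₂²ᵐ`, with `f₁` acting on the first and `f₂` on the last `m` coordinates. -/
def pairMap {m : ℕ} (f₁ f₂ : Bits m ≃+ Bits m) (v : Bits (m + m)) : Bits (m + m) :=
  Fin.append (f₁ (bobPart v)) (f₂ (charliePart v))

/-- A way for Bob and Charlie to reduce all the coset states of `W`, by circuits of Hadamard and CNOT
gates that act on the `m` qubits of one player only, to `ℓ` Bell pairs, shared between the qubit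
`i_t` of Bob and the qubit `j_t` of Charlie, and computational basis qubits: `|W_{x,z}⟩` becomes
`CNOT_{i_1,j_1} H_{i_1} ⋯ CNOT_{i_ℓ,j_ℓ} H_{i_ℓ} |f(x+z)⟩`. -/
structure Reduction {m : ℕ} (W : Grass m) where
  /-- Bob's circuit. -/
  bobCircuit : List (Gate m)
  /-- Charlie's circuit. -/
  charlieCircuit : List (Gate m)
  /-- The number `ℓ` of Bell pairs. -/
  ell : ℕ
  /-- Bob's qubits `i_1, …, i_ℓ` of the Bell pairs (numbered within Bob's half). -/
  bobIdx : Fin ell → Fin m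
  /-- Charlie's qubits `j_1, …, j_ℓ` of the Bell pairs (numbered within Charlie's half). -/
  charlieIdx : Fin ell → Fin m
  bobIdx_injective : Function.Injective bobIdx
  charlieIdx_injective : Function.Injective charlieIdx
  bobIdx_mem : ∀ t, Fin.castAdd m (bobIdx t) ∈ pivots W.1
  charlieIdx_notMem : ∀ t, Fin.natAdd m (charlieIdx t) ∉ pivots W.1
  /-- The isomorphism of Bob's half. -/
  f₁ : Bits m ≃+ Bits m
  /-- The isomorphism of Charlie's half. -/
  f₂ : Bits m ≃+ Bits m
  /-- `f₁` does not change the bits of `x` on Bob's side. -/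
  f₁_fix : ∀ x ∈ canonRep m W, f₁ (bobPart x) = bobPart x
  /-- `f₂` does not change the bits of `z` on Charlie's side. -/
  f₂_fix : ∀ z ∈ canonRepPerp m W, f₂ (charliePart z) = charliePart z
  /-- `f` maps `CS(W)` to itself. -/
  map_canonRep : ∀ x ∈ canonRep m W, pairMap f₁ f₂ x ∈ canonRep m W
  /-- `f` maps `CS(W^⊥)` to itself. -/
  map_canonRepPerp : ∀ z ∈ canonRepPerp m W, pairMap f₁ f₂ z ∈ canonRepPerp m W
  /-- The circuits take every coset state to the reduced state. -/
  reduces : ∀ x ∈ canonRep m W, ∀ z ∈ canonRepPerp m W,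
    localOp (circuitOp bobCircuit) (circuitOp charlieCircuit) *ᵥ cosetState W x z =
      (List.ofFn fun t => cnot (Fin.castAdd m (bobIdx t)) (Fin.natAdd m (charlieIdx t)) *
        hadamard (Fin.castAdd m (bobIdx t))).prod *ᵥ ket (pairMap f₁ f₂ (x + z))

namespace Reduction

variable {m : ℕ} {W : Grass m}

/-- The isomorphism `f = (f₁, f₂)`. -/
def f (R : Reduction W) : Bits (m + m) → Bits (m + m) := pairMap R.f₁ R.f₂

/-- The type of bijections
`h_W : (I ∩ [m]) \ {i_1, …, i_ℓ} → (Iᶜ ∩ [m+1, 2m]) \ {j_1, …, j_ℓ}`. -/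
abbrev Matching (R : Reduction W) : Type :=
  {i : Fin m // Fin.castAdd m i ∈ pivots W.1 ∧ i ∉ Set.range R.bobIdx} ≃
    {j : Fin m // Fin.natAdd m j ∉ pivots W.1 ∧ j ∉ Set.range R.charlieIdx}

end Reduction

/-! ### The measurements -/

/-- `|b⟩⟨b|` on one qubit. -/
def basisProj (b : ZMod 2) : Matrix (ZMod 2) (ZMod 2) ℂ := proj (Pi.single b 1)

/-- `|+i⟩ = (|0⟩ + i|1⟩)/√2`. -/
def plusI : ZMod 2 → ℂ :=
  ((1 / Real.sqrt 2 : ℝ) : ℂ) • (Pi.single 0 1 + Complex.I • Pi.single 1 1)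

/-- `|-i⟩ = (|0⟩ - i|1⟩)/√2`. -/
def minusI : ZMod 2 → ℂ :=
  ((1 / Real.sqrt 2 : ℝ) : ℂ) • (Pi.single 0 1 - Complex.I • Pi.single 1 1)

/-- `E_1 ⊗ ⋯ ⊗ E_n`. -/
def tensorAll {n : ℕ} (E : Fin n → Matrix (ZMod 2) (ZMod 2) ℂ) : Op n :=
  Matrix.of fun v w => ∏ i, E i (v i) (w i)

open Classical in
/-- Bob's operator on his `i`-th qubit of the reduced state, as a function of `y_B = f(x)`. -/
def bobQubit {m : ℕ} {W : Grass m} (R : Reduction W) (h : R.Matching) (yB : Bits (m + m))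
    (i : Fin m) : Matrix (ZMod 2) (ZMod 2) ℂ :=
  if ht : ∃ t, R.bobIdx t = i then
    if yB (Fin.natAdd m (R.charlieIdx ht.choose)) = 0 then proj plusI else proj minusI
  else if hi : Fin.castAdd m i ∈ pivots W.1 then
    basisProj (yB (Fin.natAdd m (h ⟨i, hi, ht⟩).1))
  else basisProj (yB (Fin.castAdd m i))

open Classical in
/-- Charlie's operator on his `j`-th qubit of the reduced state, as a function of `y_C = f(z)`. -/
def charlieQubit {m : ℕ} {W : Grass m} (R : Reduction W) (h : R.Matching) (yC : Bits (m + m))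
    (j : Fin m) : Matrix (ZMod 2) (ZMod 2) ℂ :=
  if ht : ∃ t, R.charlieIdx t = j then
    if yC (Fin.castAdd m (R.bobIdx ht.choose)) = 1 then proj plusI else proj minusI
  else if hj : Fin.natAdd m j ∉ pivots W.1 then
    basisProj (yC (Fin.castAdd m (h.symm ⟨j, hj, ht⟩).1))
  else basisProj (yC (Fin.natAdd m j))

/-- Bob's strategy: run the circuit, then measure with the product operators. As a POVM on the
received qubits this is `U† (⊗_i B_i) U`, where `U` is the unitary of the circuit. -/
def bobStrategy {m : ℕ} (R : ∀ W : Grass m, Reduction W) (h : ∀ W, (R W).Matching) : Answers m :=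
  fun W x => (circuitOp (R W).bobCircuit)ᴴ * tensorAll (bobQubit (R W) (h W) ((R W).f x)) *
    circuitOp (R W).bobCircuit

/-- Charlie's strategy, built in the same way. -/
def charlieStrategy {m : ℕ} (R : ∀ W : Grass m, Reduction W) (h : ∀ W, (R W).Matching) :
    Answers m :=
  fun W z => (circuitOp (R W).charlieCircuit)ᴴ *
    tensorAll (charlieQubit (R W) (h W) ((R W).f z)) * circuitOp (R W).charlieCircuit

end

end CosetGame

open CosetGame

/-!
For each `W` the value of the game is `2^{-k}`, where `k` is the dimension of the restriction of `W`
to Bob's half.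

*Upper bound.* Charlie's guess is ignored. Averaged over `z`, the projection onto `|W_{x,z}⟩` is the
uniform mixture of the basis states `|x + u⟩`, `u ∈ W` (`sum_proj_cosetState`). Each string of Bob's
half occurs there with probability at most `2^{-k}`, since `u` is uniformly random, so that a POVM
of Bob identifies `x` with probability at most `2^{-k}` (`winProbAt_le`).

*Lower bound.* Let `I` be the set of pivots of `W`. The generator matrix in reduced row echelon form
has the rows with pivot in Bob's half and those with pivot in Charlie's half; the latter vanish on
Bob's half. A shear of each half makes all the entries of the rows vanish other than at the pivots
and at the block whose rows belong to the pivots of Bob and whose columns to the non-pivots of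
Charlie. Row and column operations, which are again local to the two halves, bring this block to a
diagonal form of rank `ℓ`, and then `W` is spanned by `ℓ` vectors `e_i + e_j` and by unit vectors
(`exists_bell_basis`). The local changes of basis are CNOT circuits (`exists_circuitOp_eq_permOp`),
and together with Hadamard gates at the remaining pivots they turn `|W_{x,z}⟩` into `ℓ` Bell pairs
and basis qubits (`nonempty_reduction`). On a Bell pair the prescribed measurements are both right
with probability exactly `1/2` (`normSq_bell_amplitude`). Every other pivot of Bob is matched to a
non-pivot of Charlie, and on such a pair of qubits the two players are both right exactly if two
random bits are equal. As Bob's half contains `k` pivots, this gives `2^{-k}`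
(`winProbAt_explicit`). Representatives of the same coset give the same state up to a sign, so the
optimal value does not depend on their choice (`exists_strategy_of_reps`).

*Average.* Among the vectors of `W`, `2^{m-k}` vanish on Bob's half. All nonzero vectors lie in
equally many subspaces `W`, so that counting the pairs of a subspace and one of its vectors gives
`2 / (2^m + 1)` for the average of `2^{-k}` (`sum_half_pow_bobDim`). By the Pascal and Vandermonde
identities for `q`-binomials, this is also the value of the sum in `optimalValue`
(`optimalValue_eq`), and it is of the order `2^{-m}`.
-/

namespace CosetGame

/-! ### Pivots and coset representatives -/

lemma zmod_two_eq_one {a : ZMod 2} (h : a ≠ 0) : a = 1 := by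
  revert a; decide

section Pivots

variable {n : ℕ} {W : Submodule (ZMod 2) (Bits n)}

/-- A vector of `W` is determined by its entries at the pivots. -/
lemma eq_zero_of_pivots {w : Bits n} (hw : w ∈ W) (h : ∀ i ∈ pivots W, w i = 0) : w = 0 := by
  by_contra hne
  obtain ⟨i, hi⟩ := Function.ne_iff.mp hne
  have hex : ∃ k : ℕ, ∃ hk : k < n, w ⟨k, hk⟩ ≠ 0 := ⟨i, i.2, hi⟩
  classical
  obtain ⟨hk, hk0⟩ := Nat.find_spec hex
  refine hk0 (h _ ⟨w, hw, hk0, fun j hj => ?_⟩)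
  by_contra hj0
  exact Nat.find_min hex hj ⟨j.2, hj0⟩

/-- Gaussian elimination: the entries of a vector of `W` at the pivots can be prescribed. -/
lemma exists_mem_eq_on_pivots (W : Submodule (ZMod 2) (Bits n)) (v : Bits n) :
    ∃ w ∈ W, ∀ i ∈ pivots W, w i = v i := by
  have key : ∀ k : ℕ, ∃ w ∈ W, ∀ i ∈ pivots W, (i : ℕ) < k → w i = v i := by
    intro k
    induction k with
    | zero => exact ⟨0, W.zero_mem, fun i _ hi => absurd hi (Nat.not_lt_zero _)⟩
    | succ k ih =>
      obtain ⟨w, hw, hwv⟩ := ih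
      by_cases hk : ∃ h : k < n, (⟨k, h⟩ : Fin n) ∈ pivots W ∧ w ⟨k, h⟩ ≠ v ⟨k, h⟩
      · obtain ⟨h, ⟨r, hr, hrk, hrlt⟩, hne⟩ := hk
        refine ⟨w + r, W.add_mem hw hr, fun i hi hik => ?_⟩
        rcases Nat.lt_succ_iff_lt_or_eq.mp hik with hlt | heq
        · rw [Pi.add_apply, hrlt i hlt, add_zero, hwv i hi hlt]
        · obtain rfl : i = ⟨k, h⟩ := Fin.ext heq
          rw [Pi.add_apply, zmod_two_eq_one hrk]
          generalize w _ = a at *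
          generalize v _ = b at *
          revert a b; decide
      · push Not at hk
        refine ⟨w, hw, fun i hi hik => ?_⟩
        rcases Nat.lt_succ_iff_lt_or_eq.mp hik with hlt | heq
        · exact hwv i hi hlt
        · obtain ⟨i, hin⟩ := i
          obtain rfl : i = k := heq
          exact hk hin hi
  obtain ⟨w, hw, h⟩ := key n
  exact ⟨w, hw, fun i hi => h i hi i.2⟩

lemma existsUnique_mem_eq_on_pivots (W : Submodule (ZMod 2) (Bits n)) (v : Bits n) :
    ∃! w, w ∈ W ∧ ∀ i ∈ pivots W, w i = v i := by
  obtain ⟨w, hw, h⟩ := exists_mem_eq_on_pivots W v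
  refine ⟨w, ⟨hw, h⟩, fun w' ⟨hw', h'⟩ => sub_eq_zero.mp <|
    eq_zero_of_pivots (W.sub_mem hw' hw) fun i hi => ?_⟩
  rw [Pi.sub_apply, h i hi, h' i hi, sub_self]

/-- The vector of `W` that agrees with `v` at the pivots. -/
noncomputable def pivotLift (W : Submodule (ZMod 2) (Bits n)) : Bits n →ₗ[ZMod 2] Bits n where
  toFun v := (exists_mem_eq_on_pivots W v).choose
  map_add' u v := by
    refine (existsUnique_mem_eq_on_pivots W (u + v)).unique
      (exists_mem_eq_on_pivots W _).choose_spec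
      ⟨W.add_mem (exists_mem_eq_on_pivots W _).choose_spec.1
        (exists_mem_eq_on_pivots W _).choose_spec.1, fun i hi => ?_⟩
    rw [Pi.add_apply, (exists_mem_eq_on_pivots W u).choose_spec.2 i hi,
      (exists_mem_eq_on_pivots W v).choose_spec.2 i hi, Pi.add_apply]
  map_smul' c v := by
    refine (existsUnique_mem_eq_on_pivots W (c • v)).unique
      (exists_mem_eq_on_pivots W _).choose_spec
      ⟨W.smul_mem c (exists_mem_eq_on_pivots W _).choose_spec.1, fun i hi => ?_⟩
    rw [RingHom.id_apply, Pi.smul_apply, (exists_mem_eq_on_pivots W v).choose_spec.2 i hi,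
      Pi.smul_apply]

lemma pivotLift_mem (v : Bits n) : pivotLift W v ∈ W :=
  (exists_mem_eq_on_pivots W v).choose_spec.1

lemma pivotLift_apply (v : Bits n) {i : Fin n} (hi : i ∈ pivots W) : pivotLift W v i = v i :=
  (exists_mem_eq_on_pivots W v).choose_spec.2 i hi

lemma pivotLift_eq {v w : Bits n} (hw : w ∈ W) (h : ∀ i ∈ pivots W, w i = v i) :
    pivotLift W v = w :=
  (existsUnique_mem_eq_on_pivots W v).unique ⟨pivotLift_mem v, fun _ hi => pivotLift_apply v hi⟩
    ⟨hw, h⟩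

open Classical in
lemma card_pivots (W : Submodule (ZMod 2) (Bits n)) :
    (Finset.univ.filter (· ∈ pivots W)).card = Module.finrank (ZMod 2) W := by
  let φ : W →ₗ[ZMod 2] ({i // i ∈ pivots W} → ZMod 2) :=
    (LinearMap.funLeft (ZMod 2) (ZMod 2) Subtype.val) ∘ₗ W.subtype
  have hφ : Function.Bijective φ := by
    constructor
    · rw [← LinearMap.ker_eq_bot, LinearMap.ker_eq_bot']
      intro w hw
      exact Subtype.ext (eq_zero_of_pivots w.2 fun i hi => congrFun hw ⟨i, hi⟩)
    · intro s
      refine ⟨⟨_, pivotLift_mem (fun i => if h : i ∈ pivots W then s ⟨i, h⟩ else 0)⟩, ?_⟩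
      ext i
      change pivotLift W _ i.1 = _
      rw [pivotLift_apply _ i.2, dif_pos i.2]
  rw [(LinearEquiv.ofBijective φ hφ).finrank_eq, Module.finrank_fintype_fun_eq_card,
    Fintype.card_subtype]

lemma isCosetReps_pivots {S : Finset (Bits n)}
    (hS : ∀ x, x ∈ S ↔ ∀ i ∈ pivots W, x i = 0) : IsCosetReps W S := by
  intro v
  refine ⟨v - pivotLift W v, ⟨(hS _).2 fun i hi => ?_, ?_⟩, fun s ⟨hs, hvs⟩ => ?_⟩
  · rw [Pi.sub_apply, pivotLift_apply v hi, sub_self]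
  · rw [sub_sub_cancel]; exact pivotLift_mem v
  · have := pivotLift_eq (v := v) hvs fun i hi => by
      rw [Pi.sub_apply, (hS s).1 hs i hi, sub_zero]
    rw [this, sub_sub_cancel]

/-- If `w ∈ W`, then `w · z` depends only on the entries of `w` at the pivots, for every `z`. -/
lemma isCosetReps_perp_pivots {S : Finset (Bits n)}
    (hS : ∀ z, z ∈ S ↔ ∀ i ∉ pivots W, z i = 0) : IsCosetReps (perp W) S := by
  classical
  intro v
  have hmem : ∀ s : Bits n, s ∈ S → (v - s ∈ perp W ↔
      ∀ i ∈ pivots W, s i = pivotLift W (Pi.single i 1) ⬝ᵥ v) := by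
    intro s hs
    have hdot : ∀ w : Bits n, w ⬝ᵥ s = ∑ i with i ∈ pivots W, w i * s i := by
      intro w
      rw [Finset.sum_filter, dotProduct]
      refine Finset.sum_congr rfl fun i _ => ?_
      split_ifs with h
      · rfl
      · rw [(hS s).1 hs i h, mul_zero]
    have hsingle : ∀ i ∈ pivots W, pivotLift W (Pi.single i 1) ⬝ᵥ s = s i := by
      intro i hi
      rw [hdot, Finset.sum_eq_single i]
      · rw [pivotLift_apply _ hi, Pi.single_eq_same, one_mul]
      · intro j hj hji
        rw [pivotLift_apply _ (Finset.mem_filter.1 hj).2, Pi.single_eq_of_ne hji, zero_mul]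
      · intro h; exact absurd (Finset.mem_filter.2 ⟨Finset.mem_univ _, hi⟩) h
    constructor
    · intro h i hi
      have := h _ (pivotLift_mem (Pi.single i 1))
      rw [dotProduct_sub, hsingle i hi, sub_eq_zero] at this
      exact this.symm
    · intro h w hw
      have hzero : ∀ i ∉ pivots W, pivotLift W (Pi.single i 1) = 0 := fun i hi =>
        pivotLift_eq W.zero_mem fun j hj => by
          rw [Pi.single_eq_of_ne (ne_of_mem_of_not_mem hj hi), Pi.zero_apply]
      have hwsum : w = ∑ i, w i • pivotLift W (Pi.single i 1) := by
        rw [← pivotLift_eq hw fun _ _ => rfl]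
        nth_rw 1 [pi_eq_sum_univ' w]
        simp only [map_sum, map_smul]
        refine Finset.sum_congr rfl fun i _ => ?_
        by_cases hi : i ∈ pivots W
        · rw [pivotLift_apply _ hi]
        · rw [hzero i hi, smul_zero, smul_zero]
      rw [dotProduct_sub, sub_eq_zero, hdot]
      nth_rw 1 [hwsum]
      rw [sum_dotProduct, Finset.sum_filter]
      refine Finset.sum_congr rfl fun i _ => ?_
      split_ifs with hi
      · rw [smul_dotProduct, smul_eq_mul, h i hi]
      · rw [hzero i hi, smul_zero, zero_dotProduct]
  refine ⟨fun i => if i ∈ pivots W then pivotLift W (Pi.single i 1) ⬝ᵥ v else 0, ?_, ?_⟩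
  · have h1 : (fun i => if i ∈ pivots W then pivotLift W (Pi.single i 1) ⬝ᵥ v else 0) ∈ S :=
      (hS _).2 fun i hi => if_neg hi
    exact ⟨h1, (hmem _ h1).2 fun i hi => if_pos hi⟩
  · rintro s ⟨hs, hvs⟩
    funext i
    by_cases hi : i ∈ pivots W
    · rw [if_pos hi]; exact (hmem s hs).1 hvs i hi
    · rw [if_neg hi]; exact (hS s).1 hs i hi

end Pivots

section Reps

variable {n : ℕ} {U : Submodule (ZMod 2) (Bits n)} {S S' : Finset (Bits n)}

/-- Two sets of representatives are matched by sending a vector to the representative of its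
coset. -/
lemma IsCosetReps.exists_bijOn (h : IsCosetReps U S) (h' : IsCosetReps U S') :
    ∃ e : Bits n → Bits n, (∀ v, v - e v ∈ U) ∧ Set.BijOn e S S' := by
  choose e he he' using h'
  refine ⟨e, fun v => (he v).2, fun s _ => (he s).1, fun s hs t ht hst => ?_, fun s' hs' => ?_⟩
  · refine (h s).unique ⟨hs, by rw [sub_self]; exact U.zero_mem⟩ ⟨ht, ?_⟩
    have := U.sub_mem (he s).2 (he t).2
    rwa [hst, sub_sub_sub_cancel_right] at this
  · obtain ⟨s, ⟨hs, hss⟩, -⟩ := h s'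
    refine ⟨s, hs, (he' s s' ⟨hs', ?_⟩).symm⟩
    simpa using U.neg_mem hss

lemma IsCosetReps.sum_eq {M : Type*} [AddCommMonoid M] (h : IsCosetReps U S)
    (h' : IsCosetReps U S') (F : Bits n → M) (hF : ∀ v, ∀ u ∈ U, F (v + u) = F v) :
    ∑ s ∈ S, F s = ∑ s ∈ S', F s := by
  obtain ⟨e, he, hbij⟩ := h.exists_bijOn h'
  refine Finset.sum_bij (fun s _ => e s) (fun s hs => hbij.1 hs)
    (fun s hs t ht hst => hbij.2.1 hs ht hst) (fun s' hs' => ?_) (fun s _ => ?_)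
  · obtain ⟨s, hs, rfl⟩ := hbij.2.2 hs'
    exact ⟨s, hs, rfl⟩
  · rw [← hF (e s) _ (he s), add_sub_cancel]

lemma IsCosetReps.card_eq (h : IsCosetReps U S) (h' : IsCosetReps U S') : S.card = S'.card := by
  simpa using h.sum_eq h' (fun _ => (1 : ℕ)) fun _ _ _ => rfl

lemma IsCosetReps.translate (h : IsCosetReps U S) (a : Bits n) :
    IsCosetReps U (S.map (addRightEmbedding a)) := by
  intro v
  obtain ⟨s, ⟨hs, hvs⟩, huniq⟩ := h (v - a)
  refine ⟨s + a, ⟨Finset.mem_map_of_mem _ hs, ?_⟩, ?_⟩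
  · rwa [← sub_sub, sub_right_comm]
  · rintro t ⟨ht, hvt⟩
    obtain ⟨t, ht', rfl⟩ := Finset.mem_map.1 ht
    simp only [addRightEmbedding_apply] at hvt ⊢
    rw [huniq t ⟨ht', by rwa [sub_right_comm, sub_sub]⟩]

end Reps

section Canonical

variable {m : ℕ}

lemma mem_canonRep {W : Grass m} {x : Bits (m + m)} :
    x ∈ canonRep m W ↔ ∀ i ∈ pivots W.1, x i = 0 := by
  simp [canonRep]

lemma mem_canonRepPerp {W : Grass m} {z : Bits (m + m)} :
    z ∈ canonRepPerp m W ↔ ∀ i ∉ pivots W.1, z i = 0 := by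
  simp [canonRepPerp]

lemma areRepFamilies_canon (m : ℕ) : AreRepFamilies (canonRep m) (canonRepPerp m) := by
  classical
  exact fun W => ⟨isCosetReps_pivots fun _ => mem_canonRep,
    isCosetReps_perp_pivots fun _ => mem_canonRepPerp⟩

open Classical in
lemma card_supported {n : ℕ} (A : Set (Fin n)) (S : Finset (Bits n))
    (hS : ∀ x, x ∈ S ↔ ∀ i ∉ A, x i = 0) :
    S.card = 2 ^ (Finset.univ.filter (· ∈ A)).card := by
  have : S = Fintype.piFinset fun i => if i ∈ A then (Finset.univ : Finset (ZMod 2)) else {0} := by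
    ext x
    rw [hS, Fintype.mem_piFinset]
    refine forall_congr' fun i => ?_
    split_ifs with h <;> simp [h]
  rw [this, Fintype.card_piFinset, ← Finset.prod_const, Finset.prod_filter]
  refine Finset.prod_congr rfl fun i _ => ?_
  split_ifs <;> simp

open Classical in
lemma card_pivots_grass (W : Grass m) : (Finset.univ.filter (· ∈ pivots W.1)).card = m := by
  rw [card_pivots, W.2]

open Classical in
lemma card_not_pivots_grass (W : Grass m) :
    (Finset.univ.filter (· ∉ pivots W.1)).card = m := by
  have := Finset.card_filter_add_card_filter_not (s := Finset.univ) (· ∈ pivots W.1)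
  rw [card_pivots_grass, Finset.card_univ, Fintype.card_fin] at this
  omega

lemma card_canonRep (W : Grass m) : (canonRep m W).card = 2 ^ m := by
  classical
  rw [card_supported (pivots W.1)ᶜ _ fun x => by simp [mem_canonRep]]
  congr 1
  convert card_not_pivots_grass W

lemma card_canonRepPerp (W : Grass m) : (canonRepPerp m W).card = 2 ^ m := by
  rw [card_supported (pivots W.1) _ fun x => mem_canonRepPerp, card_pivots_grass]

lemma AreRepFamilies.card_left {S T : RepFamily m} (h : AreRepFamilies S T) (W : Grass m) :
    (S W).card = 2 ^ m := by
  rw [(h W).1.card_eq (areRepFamilies_canon m W).1, card_canonRep]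

lemma AreRepFamilies.card_right {S T : RepFamily m} (h : AreRepFamilies S T) (W : Grass m) :
    (T W).card = 2 ^ m := by
  rw [(h W).2.card_eq (areRepFamilies_canon m W).2, card_canonRepPerp]

/-- The restriction `{v₁ᵐ : v ∈ W}` of `W` to Bob's coordinates. -/
abbrev bobSpace (W : Grass m) : Submodule (ZMod 2) (Bits m) :=
  W.1.map (LinearMap.funLeft (ZMod 2) (ZMod 2) (Fin.castAdd m : Fin m → Fin (m + m)))

/-- Bob's coordinates come first, so the pivots of `W` among them are those of its restriction. -/
lemma castAdd_mem_pivots {W : Grass m} {i : Fin m} :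
    Fin.castAdd m i ∈ pivots W.1 ↔ i ∈ pivots (bobSpace W) := by
  constructor
  · rintro ⟨w, hw, hwi, hlt⟩
    exact ⟨bobPart w, ⟨w, hw, rfl⟩, hwi, fun j hj => hlt _ hj⟩
  · rintro ⟨_, ⟨w, hw, rfl⟩, hwi, hlt⟩
    refine ⟨w, hw, hwi, fun j hj => ?_⟩
    exact hlt ⟨j, lt_trans hj i.2⟩ hj

open Classical in
lemma card_bob_pivots (W : Grass m) :
    (Finset.univ.filter fun i => Fin.castAdd m i ∈ pivots W.1).card = bobDim W := by
  simp_rw [castAdd_mem_pivots]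
  exact card_pivots _

open Classical in
lemma card_charlie_not_pivots (W : Grass m) :
    (Finset.univ.filter fun j => Fin.natAdd m j ∉ pivots W.1).card = bobDim W := by
  have h := card_pivots_grass W
  rw [Finset.card_filter, Fin.sum_univ_add, ← Finset.card_filter, ← Finset.card_filter,
    card_bob_pivots] at h
  have h2 := Finset.card_filter_add_card_filter_not (s := Finset.univ)
    (fun j => Fin.natAdd m j ∈ pivots W.1)
  rw [Finset.card_univ, Fintype.card_fin] at h2
  omega

open Classical in
lemma card_and_notMem_range_add {ℓ : ℕ} (p : Fin m → Prop) (f : Fin ℓ → Fin m)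
    (hf : Function.Injective f) (hp : ∀ t, p (f t)) :
    (Finset.univ.filter fun i => p i ∧ i ∉ Set.range f).card + ℓ =
      (Finset.univ.filter p).card := by
  have h2 := Finset.card_filter_add_card_filter_not (s := Finset.univ.filter p)
    (fun i => i ∈ Set.range f)
  rw [Finset.filter_filter, Finset.filter_filter] at h2
  have h3 : (Finset.univ.filter fun i => p i ∧ i ∈ Set.range f) = Finset.univ.image f := by
    ext i
    simp only [Finset.mem_filter, Finset.mem_univ, true_and, Set.mem_range, Finset.mem_image]
    constructor
    · exact fun h => h.2
    · rintro ⟨t, rfl⟩; exact ⟨hp t, t, rfl⟩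
  rw [h3, Finset.card_image_of_injective _ hf, Finset.card_univ, Fintype.card_fin] at h2
  omega

open Classical in
/-- There are as many pivots in Bob's half as non-pivots in Charlie's half. -/
lemma nonempty_matching {W : Grass m} (R : Reduction W) : Nonempty R.Matching := by
  rw [← Fintype.card_eq]
  have h1 := card_and_notMem_range_add (fun i => Fin.castAdd m i ∈ pivots W.1) _
    R.bobIdx_injective R.bobIdx_mem
  have h2 := card_and_notMem_range_add (fun i => Fin.natAdd m i ∉ pivots W.1) _
    R.charlieIdx_injective R.charlieIdx_notMem
  rw [← Fintype.card_subtype] at h1 h2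
  rw [card_bob_pivots, ← card_charlie_not_pivots] at h1
  refine Nat.add_right_cancel (h1.trans ?_)
  convert h2.symm

end Canonical

/-! ### Product operators, permutation operators and circuits -/

noncomputable section Operators

variable {n m : ℕ}

lemma tensorAll_mul (E F : Fin n → Matrix (ZMod 2) (ZMod 2) ℂ) :
    tensorAll E * tensorAll F = tensorAll fun i => E i * F i := by
  ext v w
  simp only [tensorAll, Matrix.mul_apply, Matrix.of_apply, Fintype.prod_sum,
    Finset.prod_mul_distrib]

lemma one_apply_bits (v w : Bits n) :
    (1 : Op n) v w = ∏ i, (1 : Matrix (ZMod 2) (ZMod 2) ℂ) (v i) (w i) := by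
  by_cases h : v = w
  · subst h; simp
  · obtain ⟨i, hi⟩ := Function.ne_iff.mp h
    rw [Matrix.one_apply_ne h]
    refine (Finset.prod_eq_zero (Finset.mem_univ i) ?_).symm
    exact Matrix.one_apply_ne hi

lemma tensorAll_one : tensorAll (fun _ : Fin n => 1) = 1 := by
  ext v w
  rw [one_apply_bits]; rfl

lemma tensorAll_proj (β : Fin n → ZMod 2 → ℂ) :
    tensorAll (fun i => proj (β i)) = proj fun v => ∏ i, β i (v i) := by
  ext v w
  simp [tensorAll, proj, Matrix.vecMulVec_apply, Finset.prod_mul_distrib]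

/-- The operator `|v⟩ ↦ |g v⟩`. -/
def permOp (g : Bits n → Bits n) : Op n := Matrix.of fun v w => if v = g w then 1 else 0

lemma permOp_mul (g g' : Bits n → Bits n) : permOp g * permOp g' = permOp (g ∘ g') := by
  ext v w
  simp [permOp, Matrix.mul_apply]

lemma permOp_id : permOp (id : Bits n → Bits n) = 1 := by
  ext v w
  simp [permOp, Matrix.one_apply]

lemma mul_permOp_apply (M : Op n) (g : Bits n → Bits n) (v w : Bits n) :
    (M * permOp g) v w = M v (g w) := by
  simp [permOp, Matrix.mul_apply]

lemma permOp_mul_apply (M : Op n) (g g' : Bits n → Bits n) (h : Function.LeftInverse g' g)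
    (h' : Function.RightInverse g' g) (v w : Bits n) :
    (permOp g * M) v w = M (g' v) w := by
  rw [Matrix.mul_apply, Finset.sum_eq_single (g' v)]
  · simp [permOp, h' v]
  · intro u _ hu
    have : v ≠ g u := fun hv => hu (by rw [hv, h u])
    simp [permOp, this]
  · simp

lemma permOp_mulVec_apply (g g' : Bits n → Bits n) (h : Function.LeftInverse g' g)
    (h' : Function.RightInverse g' g) (ψ : Bits n → ℂ) (v : Bits n) :
    (permOp g *ᵥ ψ) v = ψ (g' v) := by
  rw [Matrix.mulVec, dotProduct, Finset.sum_eq_single (g' v)]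
  · simp [permOp, h' v]
  · intro u _ hu
    have : v ≠ g u := fun hv => hu (by rw [hv, h u])
    simp [permOp, this]
  · simp

lemma mulVec_ket (M : Op n) (y : Bits n) : M *ᵥ ket y = fun v => M v y := by
  ext v; simp [ket]

/-- The basis change underlying a CNOT gate. -/
def cnotMap (c t : Fin n) (w : Bits n) : Bits n := Function.update w t (w t + w c)

lemma cnot_eq_permOp (c t : Fin n) : cnot c t = permOp (cnotMap c t) := rfl

lemma cnotMap_cnotMap {c t : Fin n} (h : c ≠ t) (w : Bits n) :
    cnotMap c t (cnotMap c t w) = w := by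
  ext i
  by_cases hi : i = t
  · subst hi
    simp [cnotMap, h, add_assoc, CharTwo.add_self_eq_zero]
  · simp [cnotMap, hi]

/-- The matrix of the Hadamard gate on one qubit. -/
def hadamardMatrix : Matrix (ZMod 2) (ZMod 2) ℂ :=
  Matrix.of fun a b => ((1 / Real.sqrt 2 : ℝ) : ℂ) * sgn (a * b)

lemma sgn_zero : sgn 0 = 1 := by simp [sgn]

lemma sgn_one : sgn 1 = -1 := by simp [sgn, ZMod.val_one]

lemma sgn_add (a b : ZMod 2) : sgn (a + b) = sgn a * sgn b := by
  have h : ∀ a b : ZMod 2, (a + b).val % 2 = (a.val + b.val) % 2 := by decide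
  rw [sgn, sgn, sgn, ← pow_add, neg_one_pow_eq_pow_mod_two, h, ← neg_one_pow_eq_pow_mod_two]

lemma sgn_sum {ι : Type*} (s : Finset ι) (f : ι → ZMod 2) :
    sgn (∑ i ∈ s, f i) = ∏ i ∈ s, sgn (f i) := by
  classical
  induction s using Finset.induction_on with
  | empty => simp [sgn_zero]
  | insert a s ha ih => rw [Finset.sum_insert ha, Finset.prod_insert ha, sgn_add, ih]

lemma star_sgn (a : ZMod 2) : star (sgn a) = sgn a := by
  simp [sgn]

lemma sqrt_two_inv_sq : ((1 / Real.sqrt 2 : ℝ) : ℂ) * ((1 / Real.sqrt 2 : ℝ) : ℂ) = 1 / 2 := by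
  rw [← Complex.ofReal_mul, div_mul_div_comm, Real.mul_self_sqrt zero_le_two]
  norm_num

lemma sum_zmod_two {M : Type*} [AddCommMonoid M] (f : ZMod 2 → M) :
    ∑ a, f a = f 0 + f 1 := Fin.sum_univ_two f

lemma forall_zmod_two {p : ZMod 2 → Prop} (h0 : p 0) (h1 : p 1) : ∀ a, p a := by
  intro a
  by_cases h : a = 0
  · exact h ▸ h0
  · exact zmod_two_eq_one h ▸ h1

lemma hadamardMatrix_mul_self : hadamardMatrix * hadamardMatrix = 1 := by
  ext a b
  simp only [Matrix.mul_apply, hadamardMatrix, Matrix.of_apply, sum_zmod_two]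
  rw [mul_mul_mul_comm _ (sgn (a * 0)), mul_mul_mul_comm _ (sgn (a * 1)), sqrt_two_inv_sq]
  revert a b
  refine forall_zmod_two (forall_zmod_two ?_ ?_) (forall_zmod_two ?_ ?_) <;>
    norm_num [sgn_zero, sgn_one]

/-- Hadamard gates on all the qubits of `A`. -/
def hadamardOn (A : Finset (Fin n)) : Op n :=
  tensorAll fun i => if i ∈ A then hadamardMatrix else 1

lemma hadamard_eq (i : Fin n) : hadamard i = hadamardOn {i} := by
  ext v w
  simp only [hadamard, hadamardOn, tensorAll, Matrix.of_apply, Finset.mem_singleton]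
  rw [← Finset.mul_prod_erase _ _ (Finset.mem_univ i), if_pos rfl]
  have h : ∀ k ∈ Finset.univ.erase i, (if k = i then hadamardMatrix else 1) (v k) (w k) =
      if v k = w k then 1 else 0 := by
    intro k hk
    rw [if_neg (Finset.ne_of_mem_erase hk), Matrix.one_apply]
  rw [Finset.prod_congr rfl h, Finset.prod_ite_zero]
  simp [hadamardMatrix]

lemma hadamardOn_empty : hadamardOn (∅ : Finset (Fin n)) = 1 := by
  simp [hadamardOn, tensorAll_one]

lemma hadamardOn_mul_of_disjoint {A B : Finset (Fin n)} (h : Disjoint A B) :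
    hadamardOn A * hadamardOn B = hadamardOn (A ∪ B) := by
  rw [hadamardOn, hadamardOn, tensorAll_mul, hadamardOn]
  congr 1
  funext i
  by_cases hA : i ∈ A
  · simp [hA, Finset.disjoint_left.mp h hA]
  · simp [hA]

lemma hadamardOn_mul_self (A : Finset (Fin n)) : hadamardOn A * hadamardOn A = 1 := by
  rw [hadamardOn, tensorAll_mul, ← tensorAll_one]
  congr 1
  funext i
  split_ifs
  · exact hadamardMatrix_mul_self
  · rw [one_mul]

lemma hadamardOn_conjTranspose (A : Finset (Fin n)) : (hadamardOn A)ᴴ = hadamardOn A := by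
  ext v w
  simp only [hadamardOn, tensorAll, Matrix.conjTranspose_apply, Matrix.of_apply, star_prod]
  refine Finset.prod_congr rfl fun i _ => ?_
  split_ifs
  · simp only [hadamardMatrix, Matrix.of_apply, star_mul', star_sgn, mul_comm (v i)]
    simp
  · simp [Matrix.one_apply, eq_comm]

lemma cnot_mul_self {c t : Fin n} (h : c ≠ t) : cnot c t * cnot c t = 1 := by
  rw [cnot_eq_permOp, permOp_mul, ← permOp_id]
  congr 1
  funext w
  exact cnotMap_cnotMap h w

lemma cnot_conjTranspose {c t : Fin n} (h : c ≠ t) : (cnot c t)ᴴ = cnot c t := by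
  ext v w
  have hiff : w = cnotMap c t v ↔ v = cnotMap c t w :=
    ⟨fun h1 => by rw [h1, cnotMap_cnotMap h], fun h1 => by rw [h1, cnotMap_cnotMap h]⟩
  simp only [cnot_eq_permOp, permOp, Matrix.conjTranspose_apply, Matrix.of_apply, hiff]
  split_ifs <;> simp

lemma circuitOp_cons (g : Gate n) (L : List (Gate n)) :
    circuitOp (g :: L) = g.op * circuitOp L := by
  simp [circuitOp]

lemma circuitOp_append (L L' : List (Gate n)) :
    circuitOp (L ++ L') = circuitOp L * circuitOp L' := by
  simp [circuitOp]

lemma circuitOp_unitary (L : List (Gate n)) : (circuitOp L)ᴴ * circuitOp L = 1 := by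
  induction L with
  | nil => simp [circuitOp]
  | cons g L ih =>
    have hg : g.opᴴ * g.op = 1 := by
      cases g with
      | H i => rw [Gate.op, hadamard_eq, hadamardOn_conjTranspose, hadamardOn_mul_self]
      | CNOT c t h => rw [Gate.op, cnot_conjTranspose h, cnot_mul_self h]
    rw [circuitOp_cons, Matrix.conjTranspose_mul, Matrix.mul_assoc, ← Matrix.mul_assoc _ g.op, hg,
      Matrix.one_mul, ih]

lemma exists_circuitOp_eq_hadamardOn (A : Finset (Fin n)) :
    ∃ L : List (Gate n), circuitOp L = hadamardOn A := by
  induction A using Finset.induction_on with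
  | empty => exact ⟨[], by simp [circuitOp, hadamardOn_empty]⟩
  | insert a A ha ih =>
    obtain ⟨L, hL⟩ := ih
    refine ⟨Gate.H a :: L, ?_⟩
    rw [circuitOp_cons, hL, Gate.op, hadamard_eq,
      hadamardOn_mul_of_disjoint (Finset.disjoint_singleton_left.mpr ha), Finset.insert_eq]

/-- Over `𝔽₂` every invertible matrix is a product of transvections, and a transvection is a CNOT
gate. -/
lemma exists_circuitOp_eq_permOp (g : Bits n ≃ₗ[ZMod 2] Bits n) :
    ∃ L : List (Gate n), circuitOp L = permOp g := by
  have key : ∀ M : Matrix (Fin n) (Fin n) (ZMod 2), M.det ≠ 0 →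
      ∃ L : List (Gate n), circuitOp L = permOp fun v => M *ᵥ v := by
    intro M hM
    refine Matrix.diagonal_transvection_induction_of_det_ne_zero
      (fun M => ∃ L : List (Gate n), circuitOp L = permOp fun v => M *ᵥ v) M hM ?_ ?_ ?_
    · intro D hD
      rw [Matrix.det_diagonal, Finset.prod_ne_zero_iff] at hD
      obtain rfl : D = fun _ => 1 := funext fun i => zmod_two_eq_one (hD i (Finset.mem_univ i))
      refine ⟨[], ?_⟩
      have : (fun v : Bits n => Matrix.diagonal (fun _ => (1 : ZMod 2)) *ᵥ v) = id := by
        funext v; simp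
      rw [this, permOp_id]
      rfl
    · rintro ⟨i, j, hij, c⟩
      by_cases hc : c = 0
      · refine ⟨[], ?_⟩
        have : (fun v : Bits n => Matrix.transvection i j c *ᵥ v) = id := by
          funext v; simp [hc]
        change _ = permOp fun v : Bits n => Matrix.transvection i j c *ᵥ v
        rw [this, permOp_id]
        rfl
      · obtain rfl := zmod_two_eq_one hc
        refine ⟨[Gate.CNOT j i hij.symm], ?_⟩
        have : (fun v : Bits n => Matrix.transvection i j 1 *ᵥ v) = cnotMap j i := by
          funext v k
          rw [Matrix.transvection, Matrix.add_mulVec, Matrix.one_mulVec, Pi.add_apply,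
            Matrix.single_mulVec, cnotMap]
          by_cases hk : k = i
          · subst hk; simp
          · simp [hk]
        change _ = permOp fun v : Bits n => Matrix.transvection i j 1 *ᵥ v
        rw [this, circuitOp_cons, ← cnot_eq_permOp]
        simp [circuitOp, Gate.op]
    · rintro A B - - ⟨L, hL⟩ ⟨L', hL'⟩
      refine ⟨L ++ L', ?_⟩
      rw [circuitOp_append, hL, hL', permOp_mul]
      congr 1
      funext v
      simp
  obtain ⟨L, hL⟩ := key (LinearMap.toMatrix' (g : Bits n →ₗ[ZMod 2] Bits n))
    (LinearEquiv.isUnit_det' g |> fun h => by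
      rw [LinearMap.det_toMatrix']; exact h.ne_zero)
  refine ⟨L, hL.trans ?_⟩
  congr 1
  funext v
  rw [LinearMap.toMatrix'_mulVec]
  rfl

/-- A product operator that acts trivially on the two qubits of a CNOT gate commutes with it. -/
lemma commute_tensorAll_cnot {E : Fin n → Matrix (ZMod 2) (ZMod 2) ℂ} {c t : Fin n} (h : c ≠ t)
    (hc : E c = 1) (ht : E t = 1) : Commute (tensorAll E) (cnot c t) := by
  ext v w
  rw [cnot_eq_permOp, mul_permOp_apply,
    permOp_mul_apply _ _ _ (cnotMap_cnotMap h) (cnotMap_cnotMap h)]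
  simp only [tensorAll, Matrix.of_apply]
  by_cases hvw : v c = w c
  · refine Finset.prod_congr rfl fun i _ => ?_
    by_cases hi : i = t
    · subst hi
      simp only [ht, cnotMap, Function.update_self, Matrix.one_apply, ← hvw]
      congr 1
      rw [eq_iff_iff]
      generalize v i = a
      generalize w i = b
      generalize v c = d
      revert a b d
      decide
    · simp [cnotMap, hi]
  · rw [Finset.prod_eq_zero (Finset.mem_univ c), Finset.prod_eq_zero (Finset.mem_univ c)]
    · rw [hc, cnotMap, Function.update_of_ne h, Matrix.one_apply_ne hvw]
    · rw [hc, cnotMap, Function.update_of_ne h, Matrix.one_apply_ne hvw]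

lemma commute_hadamardOn_cnot {A : Finset (Fin n)} {c t : Fin n} (h : c ≠ t) (hc : c ∉ A)
    (ht : t ∉ A) : Commute (hadamardOn A) (cnot c t) :=
  commute_tensorAll_cnot h (by simp [hc]) (by simp [ht])

/-- The effect of the CNOT gates with controls `c t` and targets `d t` on the basis. -/
def cnotsMap {ℓ : ℕ} (c d : Fin ℓ → Fin n) (w : Bits n) : Bits n :=
  fun i => w i + ∑ t, if d t = i then w (c t) else 0

lemma cnotsMap_cnotsMap {ℓ : ℕ} {c d : Fin ℓ → Fin n} (hcd : ∀ s t, c s ≠ d t) (w : Bits n) :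
    cnotsMap c d (cnotsMap c d w) = w := by
  have hc : ∀ s, cnotsMap c d w (c s) = w (c s) := fun s => by
    rw [cnotsMap, Finset.sum_eq_zero fun t _ => if_neg (hcd s t).symm, add_zero]
  funext i
  rw [cnotsMap]
  simp only [hc]
  rw [cnotsMap, add_assoc, CharTwo.add_self_eq_zero, add_zero]

/-- The Hadamard gates can be moved past the CNOT gates of the other pairs. -/
lemma prod_cnot_mul_hadamard {ℓ : ℕ} (c d : Fin ℓ → Fin n) (hc : Function.Injective c)
    (hcd : ∀ s t, c s ≠ d t) :
    (List.ofFn fun t => cnot (c t) (d t) * hadamard (c t)).prod =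
      permOp (cnotsMap c d) * hadamardOn (Finset.univ.image c) ∧
    ∀ A : Finset (Fin n), (∀ t, c t ∉ A) → (∀ t, d t ∉ A) →
      Commute (hadamardOn A) (permOp (cnotsMap c d)) := by
  induction ℓ with
  | zero =>
    have : cnotsMap c d = id := by funext w i; simp [cnotsMap]
    simp [this, permOp_id, hadamardOn_empty, Commute.one_right]
  | succ ℓ ih =>
    obtain ⟨ih1, ih2⟩ := ih (fun t => c t.succ) (fun t => d t.succ)
      (hc.comp (Fin.succ_injective _)) fun s t => hcd _ _
    have hmap : permOp (cnotsMap c d) = cnot (c 0) (d 0) *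
        permOp (cnotsMap (fun t => c t.succ) (fun t => d t.succ)) := by
      rw [cnot_eq_permOp, permOp_mul]
      congr 1
      funext w i
      have h0 : (∑ t : Fin ℓ, if d t.succ = c 0 then w (c t.succ) else 0) = 0 :=
        Finset.sum_eq_zero fun t _ => if_neg (hcd _ _).symm
      by_cases hi : i = d 0
      · subst hi
        simp only [cnotsMap, Function.comp, cnotMap, Function.update_self, Fin.sum_univ_succ, h0,
          if_true, add_zero]
        ring
      · simp only [cnotsMap, Function.comp, cnotMap, Function.update_of_ne hi, Fin.sum_univ_succ,
          if_neg (Ne.symm hi), zero_add]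
    constructor
    · rw [List.ofFn_succ, List.prod_cons, ih1, hmap, hadamard_eq, Matrix.mul_assoc,
        ← Matrix.mul_assoc (hadamardOn {c 0}),
        (ih2 {c 0} (fun t => by simp [hc.eq_iff]) fun t => by simp [(hcd _ _).symm]).eq,
        Matrix.mul_assoc, hadamardOn_mul_of_disjoint, Matrix.mul_assoc]
      · congr 3
        rw [Fin.univ_succ, Finset.cons_eq_insert, Finset.image_insert, Finset.insert_eq]
        congr 1
        ext i
        simp [Fin.exists_fin_succ, Fin.succ_ne_zero]
      · simp [hc.eq_iff]
    · intro A hA hA'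
      rw [hmap]
      exact (commute_hadamardOn_cnot (hcd 0 0) (hA 0) (hA' 0)).mul_right
        (ih2 A (fun t => hA _) fun t => hA' _)

end Operators

noncomputable section Local

variable {m : ℕ}

@[simp] lemma bobPart_append (b c : Bits m) : bobPart (Fin.append b c) = b := by
  funext i; simp [bobPart]

@[simp] lemma charliePart_append (b c : Bits m) : charliePart (Fin.append b c) = c := by
  funext i; simp [charliePart, -Fin.natAdd_eq_addNat]

@[simp] lemma append_parts (v : Bits (m + m)) : Fin.append (bobPart v) (charliePart v) = v := by
  funext i
  refine Fin.addCases (fun i => ?_) (fun i => ?_) i <;>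
    simp [bobPart, charliePart, -Fin.natAdd_eq_addNat]

/-- Splitting a string into the two halves. -/
def splitEquiv (m : ℕ) : Bits (m + m) ≃ Bits m × Bits m where
  toFun v := (bobPart v, charliePart v)
  invFun p := Fin.append p.1 p.2
  left_inv v := append_parts v
  right_inv p := by simp

lemma localOp_mul (A A' B B' : Op m) :
    localOp (A * A') (B * B') = localOp A B * localOp A' B' := by
  rw [localOp, Matrix.mul_kronecker_mul]
  exact (Matrix.submatrix_mul_equiv (A ⊗ₖ B) (A' ⊗ₖ B') (splitEquiv m) (splitEquiv m)
    (splitEquiv m)).symm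

lemma localOp_conjTranspose (A B : Op m) : (localOp A B)ᴴ = localOp Aᴴ Bᴴ := by
  rw [localOp, localOp, Matrix.conjTranspose_submatrix, Matrix.conjTranspose_kronecker]

lemma localOp_apply (A B : Op m) (v w : Bits (m + m)) :
    localOp A B v w = A (bobPart v) (bobPart w) * B (charliePart v) (charliePart w) := rfl

lemma localOp_tensorAll (E F : Fin m → Matrix (ZMod 2) (ZMod 2) ℂ) :
    localOp (tensorAll E) (tensorAll F) = tensorAll (Fin.append E F) := by
  ext v w
  simp [localOp_apply, tensorAll, Fin.prod_univ_add, bobPart, charliePart,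
    -Fin.natAdd_eq_addNat]

lemma localOp_permOp (g g' : Bits m → Bits m) :
    localOp (permOp g) (permOp g') =
      permOp fun v => Fin.append (g (bobPart v)) (g' (charliePart v)) := by
  ext v w
  have : v = Fin.append (g (bobPart w)) (g' (charliePart w)) ↔
      bobPart v = g (bobPart w) ∧ charliePart v = g' (charliePart w) := by
    constructor
    · rintro rfl; simp
    · rintro ⟨h1, h2⟩; rw [← h1, ← h2, append_parts]
  simp only [localOp_apply, permOp, Matrix.of_apply, this]
  split_ifs <;> simp_all

lemma localOp_posSemidef {A B : Op m} (hA : A.PosSemidef) (hB : B.PosSemidef) :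
    (localOp A B).PosSemidef :=
  (hA.kronecker hB).submatrix _

lemma localOp_sum_right {ι : Type*} (s : Finset ι) (A : Op m) (B : ι → Op m) :
    localOp A (∑ i ∈ s, B i) = ∑ i ∈ s, localOp A (B i) := by
  ext v w
  simp [localOp_apply, Matrix.sum_apply, Finset.mul_sum]

/-- The expectation of an operator in a pure state. -/
lemma trace_mul_proj {α : Type} [Fintype α] (M : Matrix α α ℂ) (ψ : α → ℂ) :
    Matrix.trace (M * proj ψ) = star ψ ⬝ᵥ (M *ᵥ ψ) := by
  rw [proj, Matrix.mul_vecMulVec, Matrix.trace_vecMulVec, dotProduct_comm]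

end Local

/-! ### Coset states and the upper bound -/

noncomputable section UpperBound

variable {m : ℕ}

open Classical in
lemma cosetState_apply (W : Grass m) (x z v : Bits (m + m)) :
    cosetState W x z v = ((1 / Real.sqrt (2 ^ m) : ℝ) : ℂ) *
      if v - x ∈ W.1 then sgn (z ⬝ᵥ (v - x)) else 0 := by
  simp only [cosetState, Pi.smul_apply, Finset.sum_apply, smul_eq_mul]
  congr 1
  have h : ∀ u : Bits (m + m), ket (x + u) v = if u = v - x then (1 : ℂ) else 0 := by
    intro u
    simp only [ket, Pi.single_apply]
    congr 1
    rw [eq_iff_iff, eq_sub_iff_add_eq', eq_comm]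
  simp only [h, mul_ite, mul_one, mul_zero]
  rw [Finset.sum_ite_eq']
  simp

lemma sqrt_two_pow_inv_sq (m : ℕ) :
    ((1 / Real.sqrt (2 ^ m) : ℝ) : ℂ) * ((1 / Real.sqrt (2 ^ m) : ℝ) : ℂ) = 1 / 2 ^ m := by
  rw [← Complex.ofReal_mul, div_mul_div_comm, Real.mul_self_sqrt (by positivity)]
  norm_num

open Classical in
lemma proj_cosetState_apply (W : Grass m) (x z v v' : Bits (m + m)) :
    proj (cosetState W x z) v v' = if v - x ∈ W.1 ∧ v' - x ∈ W.1 then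
      1 / 2 ^ m * sgn (z ⬝ᵥ (v - v')) else 0 := by
  have hz : z ⬝ᵥ (v - v') = z ⬝ᵥ (v - x) + z ⬝ᵥ (v' - x) := by
    rw [← CharTwo.sub_eq_add, ← dotProduct_sub, sub_sub_sub_cancel_right]
  rw [proj, Matrix.vecMulVec_apply, Pi.star_apply, cosetState_apply, cosetState_apply, hz, sgn_add,
    ← sqrt_two_pow_inv_sq]
  by_cases h1 : v - x ∈ W.1 <;> by_cases h2 : v' - x ∈ W.1
  · simp only [h1, h2, and_self, if_true, star_mul', star_sgn, Complex.star_def,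
      Complex.conj_ofReal]
    ring
  all_goals simp [h1, h2]

/-- Changing the representatives of the cosets changes the coset state by a sign only. -/
lemma proj_cosetState_add (W : Grass m) (x z : Bits (m + m)) {u w : Bits (m + m)} (hu : u ∈ W.1)
    (hw : w ∈ perp W.1) :
    proj (cosetState W (x + u) (z + w)) = proj (cosetState W x z) := by
  classical
  have hmem : ∀ v, v - (x + u) ∈ W.1 ↔ v - x ∈ W.1 := fun v => by
    rw [← sub_sub]; exact W.1.sub_mem_iff_left hu
  ext v v'
  rw [proj_cosetState_apply, proj_cosetState_apply, hmem, hmem]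
  split_ifs with h
  · have : (v - v') ⬝ᵥ w = 0 := hw _ (by simpa using W.1.sub_mem h.1 h.2)
    rw [add_dotProduct, dotProduct_comm w, this, add_zero]
  · rfl

lemma exists_dotProduct_eq_one {n : ℕ} {d : Bits n} (hd : d ≠ 0) : ∃ a : Bits n, a ⬝ᵥ d = 1 := by
  obtain ⟨i, hi⟩ := Function.ne_iff.mp hd
  exact ⟨Pi.single i 1, by rw [single_dotProduct, one_mul]; exact zmod_two_eq_one hi⟩

/-- Characters of `W`, indexed by representatives of `W^⊥`, are orthogonal. -/
lemma sum_sgn_dotProduct {W : Grass m} {T : Finset (Bits (m + m))} (hT : IsCosetReps (perp W.1) T)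
    {d : Bits (m + m)} (hd : d ∈ W.1) (hd0 : d ≠ 0) : ∑ z ∈ T, sgn (z ⬝ᵥ d) = 0 := by
  obtain ⟨a, ha⟩ := exists_dotProduct_eq_one hd0
  have h := hT.sum_eq (hT.translate a) (fun z => sgn (z ⬝ᵥ d)) fun v u hu => by
    rw [add_dotProduct, dotProduct_comm u, hu d hd, add_zero]
  rw [Finset.sum_map] at h
  simp only [addRightEmbedding_apply, add_dotProduct, ha, sgn_add, sgn_one, mul_neg, mul_one,
    Finset.sum_neg_distrib] at h
  exact self_eq_neg.mp h

open Classical in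
/-- Averaging over `z` removes all the coherences: a player who does not know `z` sees a uniformly
random element of the coset `x + W`. -/
lemma sum_proj_cosetState {W : Grass m} {T : Finset (Bits (m + m))}
    (hT : IsCosetReps (perp W.1) T) (hcard : T.card = 2 ^ m) (x : Bits (m + m)) :
    ∑ z ∈ T, proj (cosetState W x z) =
      Matrix.diagonal fun v => if v - x ∈ W.1 then 1 else 0 := by
  ext v v'
  rw [Matrix.sum_apply]
  simp only [proj_cosetState_apply]
  by_cases hv : v = v'
  · subst hv
    rw [Matrix.diagonal_apply_eq]
    simp only [sub_self, dotProduct_zero, sgn_zero, and_self]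
    split_ifs
    · simp [hcard]
    · simp
  · rw [Matrix.diagonal_apply_ne _ hv]
    by_cases h : v - x ∈ W.1 ∧ v' - x ∈ W.1
    · simp only [if_pos h]
      rw [← Finset.mul_sum, sum_sgn_dotProduct hT _ (sub_ne_zero.mpr hv), mul_zero]
      simpa using W.1.sub_mem h.1 h.2
    · simp [if_neg h]

/-- The vectors of `W` that vanish on Bob's half, as strings on Charlie's half. -/
def charlieKer (W : Grass m) : Set (Bits m) := {c | Fin.append 0 c ∈ W.1}

lemma ncard_charlieKer_mul (W : Grass m) : (charlieKer W).ncard * 2 ^ bobDim W = 2 ^ m := by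
  let φ : W.1 →ₗ[ZMod 2] Bits m :=
    (LinearMap.funLeft (ZMod 2) (ZMod 2) (Fin.castAdd m : Fin m → Fin (m + m))) ∘ₗ W.1.subtype
  have hrange : Module.finrank (ZMod 2) (LinearMap.range φ) = bobDim W := by
    rw [LinearMap.range_comp, Submodule.range_subtype]; rfl
  have hrn := LinearMap.finrank_range_add_finrank_ker φ
  rw [hrange, W.2] at hrn
  have hker : Nat.card (LinearMap.ker φ) = (charlieKer W).ncard := by
    rw [← Nat.card_coe_set_eq]
    refine Nat.card_congr ⟨fun w => ⟨charliePart w.1.1, ?_⟩,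
      fun c => ⟨⟨Fin.append 0 c.1, c.2⟩, ?_⟩, fun w => ?_, fun c => ?_⟩
    · have h : bobPart w.1.1 = 0 := w.2
      change Fin.append 0 _ ∈ W.1
      rw [← h, append_parts]
      exact w.1.2
    · exact bobPart_append 0 c.1
    · have h : bobPart w.1.1 = 0 := w.2
      ext1; ext1
      change Fin.append 0 (charliePart w.1.1) = w.1.1
      rw [← h, append_parts]
    · exact Subtype.ext (charliePart_append 0 c.1)
  rw [← hker, Module.natCard_eq_pow_finrank (K := ZMod 2), Nat.card_zmod, ← pow_add, add_comm, hrn]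

lemma half_pow_bobDim (W : Grass m) :
    (1 / 2 : ℝ) ^ bobDim W = (charlieKer W).ncard / 2 ^ m := by
  have h : ((charlieKer W).ncard : ℝ) * 2 ^ bobDim W = 2 ^ m := mod_cast ncard_charlieKer_mul W
  rw [← h, one_div, inv_pow]
  have : ((charlieKer W).ncard : ℝ) ≠ 0 := fun h0 => by
    rw [h0, zero_mul] at h; exact absurd h.symm (by positivity)
  field_simp

open Classical in
lemma card_fiber_le (W : Grass m) (x : Bits (m + m)) (b : Bits m) :
    (Finset.univ.filter fun v => v - x ∈ W.1 ∧ bobPart v = b).card ≤ (charlieKer W).ncard := by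
  rcases Finset.eq_empty_or_nonempty
    (Finset.univ.filter fun v => v - x ∈ W.1 ∧ bobPart v = b) with h | ⟨v₀, hv₀⟩
  · rw [h]; simp
  · obtain ⟨-, hv₀, hb⟩ := Finset.mem_filter.1 hv₀
    rw [← Set.ncard_coe_finset]
    have hpart : ∀ v, bobPart v = b → Fin.append 0 (charliePart v - charliePart v₀) = v - v₀ := by
      intro v hv
      rw [← append_parts (v - v₀)]
      congr 1
      change _ = bobPart v - bobPart v₀
      rw [hv, hb, sub_self]
    refine Set.ncard_le_ncard_of_injOn (fun v => charliePart v - charliePart v₀) ?_ ?_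
      (Set.toFinite _)
    · intro v hv
      simp only [Finset.coe_filter, Finset.mem_univ, true_and, Set.mem_ofPred_eq] at hv
      change Fin.append 0 (charliePart v - charliePart v₀) ∈ W.1
      rw [hpart v hv.2]
      simpa using W.1.sub_mem hv.1 hv₀
    · intro v hv v' hv' hvv
      simp only [Finset.coe_filter, Finset.mem_univ, true_and, Set.mem_ofPred_eq] at hv hv'
      have := (hpart v hv.2).symm.trans ((congrArg (Fin.append 0) hvv).trans (hpart v' hv'.2))
      exact sub_left_injective this

/-- Charlie's part of the winning condition is dropped. -/
lemma sum_winProbXZ_le {S T : RepFamily m} (hST : AreRepFamilies S T) {B C : Answers m}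
    (h : IsStrategy S T B C) (W : Grass m) {x : Bits (m + m)} (hx : x ∈ S W) :
    ∑ z ∈ T W, winProbXZ B C W x z ≤ (charlieKer W).ncard * (B W x).trace.re := by
  classical
  have hB := (h W).1.1 x hx
  calc ∑ z ∈ T W, winProbXZ B C W x z
      ≤ ∑ z ∈ T W, ((localOp (B W x) 1 * proj (cosetState W x z)).trace).re := by
        refine Finset.sum_le_sum fun z hz => ?_
        rw [← (h W).2.2, localOp_sum_right, Finset.sum_mul, Matrix.trace_sum, Complex.re_sum]
        refine Finset.single_le_sum (f := fun z' =>
          (localOp (B W x) (C W z') * proj (cosetState W x z)).trace.re) (fun z' hz' => ?_) hz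
        rw [trace_mul_proj]
        exact (Complex.nonneg_iff.1 ((localOp_posSemidef hB
          ((h W).2.1 z' hz')).dotProduct_mulVec_nonneg (cosetState W x z))).1
    _ = ∑ v with v - x ∈ W.1, (B W x (bobPart v) (bobPart v)).re := by
        rw [← Complex.re_sum, ← Matrix.trace_sum, ← Finset.mul_sum,
          sum_proj_cosetState (hST W).2 (hST.card_right W), Matrix.trace, Finset.sum_filter,
          Complex.re_sum]
        refine Finset.sum_congr rfl fun v _ => ?_
        rw [Matrix.diag_apply, Matrix.mul_diagonal, localOp_apply, Matrix.one_apply_eq, mul_one]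
        split_ifs <;> simp
    _ = ∑ b, ∑ v with v - x ∈ W.1 ∧ bobPart v = b, (B W x b b).re := by
        rw [← Finset.sum_fiberwise _ bobPart]
        refine Finset.sum_congr rfl fun b _ => ?_
        rw [Finset.filter_filter]
        refine Finset.sum_congr rfl fun v hv => ?_
        rw [(Finset.mem_filter.1 hv).2.2]
    _ ≤ ∑ b, (charlieKer W).ncard * (B W x b b).re := by
        refine Finset.sum_le_sum fun b _ => ?_
        rw [Finset.sum_const, nsmul_eq_mul]
        exact mul_le_mul_of_nonneg_right (Nat.cast_le.mpr (card_fiber_le W x b))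
          (Complex.nonneg_iff.1 hB.diag_nonneg).1
    _ = (charlieKer W).ncard * (B W x).trace.re := by
        rw [← Finset.mul_sum, Matrix.trace, Complex.re_sum]
        rfl

/-- No strategy wins with probability more than `2^{-k}`: already Bob alone does not guess `x` with
a higher probability. -/
lemma winProbAt_le {S T : RepFamily m} (hST : AreRepFamilies S T) {B C : Answers m}
    (h : IsStrategy S T B C) (W : Grass m) : winProbAt S T B C W ≤ (1 / 2) ^ bobDim W := by
  rw [winProbAt, hST.card_left, hST.card_right, half_pow_bobDim, div_le_div_iff₀ (by positivity)
    (by positivity)]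
  have hsum : ∑ x ∈ S W, ∑ z ∈ T W, winProbXZ B C W x z ≤ (charlieKer W).ncard * 2 ^ m := by
    calc _ ≤ ∑ x ∈ S W, (charlieKer W).ncard * (B W x).trace.re :=
          Finset.sum_le_sum fun x hx => sum_winProbXZ_le hST h W hx
      _ = (charlieKer W).ncard * 2 ^ m := by
          rw [← Finset.mul_sum, ← Complex.re_sum, ← Matrix.trace_sum, (h W).1.2, Matrix.trace_one,
            Complex.natCast_re]
          simp [ZMod.card]
  calc _ ≤ ((charlieKer W).ncard * 2 ^ m : ℝ) * 2 ^ m := by gcongr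
    _ = _ := by push_cast; ring

end UpperBound

/-! ### Averaging over the subspaces -/

noncomputable section Average

variable {m : ℕ}

/-- A transvection along `v + w` that maps `v` to `w`. -/
lemma exists_linearEquiv_apply_eq {n : ℕ} {v w : Bits n} (hv : v ≠ 0) (hw : w ≠ 0) :
    ∃ g : Bits n ≃ₗ[ZMod 2] Bits n, g v = w := by
  obtain ⟨a, hav, haw⟩ : ∃ a : Bits n, a ⬝ᵥ v = 1 ∧ a ⬝ᵥ w = 1 := by
    obtain ⟨a, ha⟩ := exists_dotProduct_eq_one hv
    obtain ⟨b, hb⟩ := exists_dotProduct_eq_one hw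
    by_cases haw : a ⬝ᵥ w = 0
    · by_cases hbv : b ⬝ᵥ v = 0
      · exact ⟨a + b, by rw [add_dotProduct, ha, hbv, add_zero],
          by rw [add_dotProduct, haw, hb, zero_add]⟩
      · exact ⟨b, zmod_two_eq_one hbv, hb⟩
    · exact ⟨a, ha, zmod_two_eq_one haw⟩
  let g : Bits n →ₗ[ZMod 2] Bits n :=
    { toFun := fun x => x + (a ⬝ᵥ x) • (v + w)
      map_add' := fun x y => by rw [dotProduct_add, add_smul]; abel
      map_smul' := fun c x => by
        rw [dotProduct_smul, smul_eq_mul, mul_smul, RingHom.id_apply, smul_add c x] }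
  have hg : ∀ x, g (g x) = x := by
    intro x
    change x + (a ⬝ᵥ x) • (v + w) + (a ⬝ᵥ (x + (a ⬝ᵥ x) • (v + w))) • (v + w) = x
    rw [dotProduct_add, dotProduct_smul, dotProduct_add, hav, haw, CharTwo.add_self_eq_zero,
      smul_zero, add_zero, add_assoc, ← add_smul, CharTwo.add_self_eq_zero, zero_smul, add_zero]
  refine ⟨LinearEquiv.ofInvolutive g hg, ?_⟩
  change v + (a ⬝ᵥ v) • (v + w) = w
  rw [hav, one_smul, ← add_assoc, ZModModule.add_self, zero_add]

open Classical in
/-- All nonzero vectors lie in equally many `m`-dimensional subspaces. -/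
lemma exists_card_filter_mem (m : ℕ) : ∃ N : ℕ, ∀ v : Bits (m + m), v ≠ 0 →
    (Finset.univ.filter fun W : Grass m => v ∈ W.1).card = N := by
  by_cases h : ∃ w : Bits (m + m), w ≠ 0
  · obtain ⟨w, hw⟩ := h
    refine ⟨(Finset.univ.filter fun W : Grass m => w ∈ W.1).card, fun v hv => ?_⟩
    have hle : ∀ {v w : Bits (m + m)}, v ≠ 0 → w ≠ 0 →
        (Finset.univ.filter fun W : Grass m => v ∈ W.1).card ≤
          (Finset.univ.filter fun W : Grass m => w ∈ W.1).card := by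
      intro v w hv hw
      obtain ⟨g, hg⟩ := exists_linearEquiv_apply_eq hv hw
      refine Finset.card_le_card_of_injOn
        (fun W => ⟨W.1.map (g : Bits (m + m) →ₗ[ZMod 2] Bits (m + m)), ?_⟩) ?_ ?_
      · rw [LinearEquiv.finrank_map_eq, W.2]
      · intro W hW
        simp only [Finset.coe_filter, Finset.mem_univ, true_and, Set.mem_ofPred_eq] at hW ⊢
        exact ⟨v, hW, hg⟩
      · intro W _ W' _ hWW'
        refine Subtype.ext (Submodule.map_injective_of_injective g.injective ?_)
        exact congrArg Subtype.val hWW'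
    exact (hle hv hw).antisymm (hle hw hv)
  · push Not at h
    exact ⟨0, fun v hv => absurd (h v) hv⟩

lemma sum_card_filter_mem {ι α : Type*} [Fintype ι] (A : Finset α) (r : ι → α → Prop)
    [∀ i a, Decidable (r i a)] :
    ∑ i, (A.filter (r i)).card = ∑ a ∈ A, (Finset.univ.filter fun i => r i a).card := by
  simp only [Finset.card_filter]
  exact Finset.sum_comm

instance (m : ℕ) : Nonempty (Grass m) := by
  let φ : Bits m →ₗ[ZMod 2] Bits (m + m) :=
    { toFun := fun b => Fin.append b 0
      map_add' := fun b c => by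
        rw [← append_parts (Fin.append b 0 + Fin.append c 0)]
        congr 1
        · change _ = bobPart (Fin.append b 0) + bobPart (Fin.append c 0)
          rw [bobPart_append, bobPart_append]
        · change _ = charliePart (Fin.append b 0) + charliePart (Fin.append c 0)
          rw [charliePart_append, charliePart_append, add_zero]
      map_smul' := fun a b => by
        rw [← append_parts ((RingHom.id _) a • Fin.append b 0)]
        congr 1
        · change _ = a • bobPart (Fin.append b 0)
          rw [bobPart_append]
        · change _ = a • charliePart (Fin.append b 0)
          rw [charliePart_append, smul_zero] }
  have hφ : Function.Injective φ := fun b c h => by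
    have : bobPart (φ b) = bobPart (φ c) := by rw [h]
    simpa [φ] using this
  exact ⟨⟨LinearMap.range φ, by
    rw [LinearMap.finrank_range_of_inj hφ, Module.finrank_fin_fun]⟩⟩

/-- Double counting of the incidences of vectors and subspaces gives the average of `2^{-k}`, since
`2^{m-k}` vectors of `W` vanish on Bob's half. -/
lemma sum_half_pow_bobDim (m : ℕ) :
    (∑ W : Grass m, (1 / 2 : ℝ) ^ bobDim W) / Fintype.card (Grass m) = 2 / (2 ^ m + 1) := by
  classical
  obtain ⟨N, hN⟩ := exists_card_filter_mem m
  have hG : (Fintype.card (Grass m) : ℝ) ≠ 0 := Nat.cast_ne_zero.mpr Fintype.card_ne_zero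
  have hzero : (Finset.univ.filter fun W : Grass m => (0 : Bits (m + m)) ∈ W.1).card =
      Fintype.card (Grass m) := by
    simp [Finset.card_univ]
  have h1 : (Fintype.card (Grass m) : ℝ) * (2 ^ m - 1) = (2 ^ m * 2 ^ m - 1) * N := by
    have h := sum_card_filter_mem (Finset.univ : Finset (Bits (m + m)))
      fun (W : Grass m) v => v ∈ W.1
    have hcard : ∀ W : Grass m, (Finset.univ.filter fun v => v ∈ W.1).card = 2 ^ m := by
      intro W
      rw [← Fintype.card_subtype]
      have := Module.card_eq_pow_finrank (K := ZMod 2) (V := W.1)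
      rw [W.2, ZMod.card] at this
      exact this
    rw [Finset.sum_congr rfl fun W _ => hcard W, Finset.sum_const, Finset.card_univ,
      ← Finset.add_sum_erase _ _ (Finset.mem_univ (0 : Bits (m + m))), hzero,
      Finset.sum_congr rfl fun v hv => hN v (Finset.ne_of_mem_erase hv), Finset.sum_const,
      smul_eq_mul, smul_eq_mul] at h
    have hcu : ((Finset.univ.erase (0 : Bits (m + m))).card : ℝ) = 2 ^ m * 2 ^ m - 1 := by
      rw [Finset.cast_card_erase_of_mem (Finset.mem_univ _), Finset.card_univ]
      simp [ZMod.card, pow_add]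
    have h' : (Fintype.card (Grass m) : ℝ) * 2 ^ m =
        Fintype.card (Grass m) + (Finset.univ.erase (0 : Bits (m + m))).card * N := mod_cast h
    rw [hcu] at h'
    linarith
  have h2 : (∑ W : Grass m, ((charlieKer W).ncard : ℝ)) =
      Fintype.card (Grass m) + (2 ^ m - 1) * N := by
    have h := sum_card_filter_mem (Finset.univ : Finset (Bits m))
      fun (W : Grass m) c => Fin.append 0 c ∈ W.1
    have hcard : ∀ W : Grass m, (Finset.univ.filter fun c => Fin.append 0 c ∈ W.1).card =
        (charlieKer W).ncard := by
      intro W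
      rw [← Set.ncard_coe_finset]
      congr 1
      ext c
      simp [charlieKer]
    have hne : ∀ c : Bits m, c ≠ 0 → Fin.append (0 : Bits m) c ≠ 0 := fun c hc h => hc <| by
      rw [← charliePart_append (0 : Bits m) c, h]; rfl
    have happ : Fin.append (0 : Bits m) (0 : Bits m) = 0 := by
      rw [← append_parts (0 : Bits (m + m))]; rfl
    rw [Finset.sum_congr rfl fun W _ => hcard W,
      ← Finset.add_sum_erase _ _ (Finset.mem_univ (0 : Bits m)), happ, hzero,
      Finset.sum_congr rfl fun c hc => hN _ (hne c (Finset.ne_of_mem_erase hc)),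
      Finset.sum_const, smul_eq_mul] at h
    have hcu : ((Finset.univ.erase (0 : Bits m)).card : ℝ) = 2 ^ m - 1 := by
      rw [Finset.cast_card_erase_of_mem (Finset.mem_univ _), Finset.card_univ]
      simp [ZMod.card]
    rw [← hcu]
    exact_mod_cast h
  simp only [half_pow_bobDim]
  rw [← Finset.sum_div, h2, div_div, div_eq_div_iff (by positivity) (by positivity)]
  linear_combination (-1 : ℝ) * h1

end Average

/-! ### The `q`-binomial identity -/

section QBinom

local notation "qb" => qBinom 2

lemma two_pow_succ_sub_one_ne_zero (k : ℕ) : (2 : ℝ) ^ (k + 1) - 1 ≠ 0 :=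
  sub_ne_zero.mpr (one_lt_pow₀ one_lt_two k.succ_ne_zero).ne'

@[simp] lemma qBinom_zero_right (n : ℕ) : qb n 0 = 1 := by simp [qBinom]

lemma qBinom_eq_zero {n k : ℕ} (h : n < k) : qb n k = 0 :=
  Finset.prod_eq_zero (Finset.mem_range.mpr h) (by simp)

lemma qBinom_succ_succ_mul (n k : ℕ) :
    qb (n + 1) (k + 1) * (2 ^ (k + 1) - 1) = qb n k * (2 ^ (n + 1) - 1) := by
  have h := two_pow_succ_sub_one_ne_zero k
  rw [qBinom, Finset.prod_range_succ']
  simp only [Nat.add_sub_add_right, Nat.sub_zero]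
  rw [← qBinom, mul_assoc, div_mul_cancel₀ _ h]

lemma qBinom_succ_right_mul (n k : ℕ) :
    qb n (k + 1) * (2 ^ (k + 1) - 1) = qb n k * (2 ^ (n - k) - 1) := by
  have h := two_pow_succ_sub_one_ne_zero k
  rw [qBinom, qBinom, Finset.prod_div_distrib, Finset.prod_div_distrib,
    Finset.prod_range_succ (fun j => (2 : ℝ) ^ (n - j) - 1),
    Finset.prod_range_succ' (fun j => (2 : ℝ) ^ (k + 1 - j) - 1)]
  simp only [Nat.add_sub_add_right, Nat.sub_zero]
  rw [div_mul_eq_mul_div, div_mul_eq_mul_div, mul_div_mul_right _ _ h]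

lemma qBinom_pascal (n k : ℕ) :
    qb (n + 1) (k + 1) = qb n k + 2 ^ (k + 1) * qb n (k + 1) := by
  rcases le_or_gt k n with hk | hk
  · have h := two_pow_succ_sub_one_ne_zero k
    have hpow : (2 : ℝ) ^ (k + 1) * 2 ^ (n - k) = 2 ^ (n + 1) := by
      rw [← pow_add]; congr 1; omega
    refine mul_right_cancel₀ h ?_
    rw [qBinom_succ_succ_mul, add_mul, mul_assoc, qBinom_succ_right_mul, ← hpow]
    ring
  · rw [qBinom_eq_zero hk, qBinom_eq_zero (Nat.succ_lt_succ hk),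
      qBinom_eq_zero (hk.trans k.lt_succ_self)]
    ring

/-- The `q`-analogue of `(a+b)! = [a+b choose a] a! b!` for `q = 2`. -/
lemma qBinom_add_mul (a b : ℕ) :
    qb (a + b) a * ((∏ j ∈ Finset.range a, ((2 : ℝ) ^ (j + 1) - 1)) *
      ∏ j ∈ Finset.range b, ((2 : ℝ) ^ (j + 1) - 1)) =
        ∏ j ∈ Finset.range (a + b), ((2 : ℝ) ^ (j + 1) - 1) := by
  induction a generalizing b with
  | zero => simp
  | succ a ih =>
    have h := qBinom_succ_right_mul (a + 1 + b) a
    rw [show a + 1 + b - a = b + 1 by omega] at h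
    have h2 := ih (b + 1)
    rw [show a + (b + 1) = a + 1 + b by omega, Finset.prod_range_succ] at h2
    rw [← h2, Finset.prod_range_succ _ a]
    linear_combination ((∏ j ∈ Finset.range a, ((2 : ℝ) ^ (j + 1) - 1)) *
      ∏ j ∈ Finset.range b, ((2 : ℝ) ^ (j + 1) - 1)) * h

lemma qBinom_symm (a b : ℕ) : qb (a + b) a = qb (a + b) b := by
  have hne : ∀ c : ℕ, ∏ j ∈ Finset.range c, ((2 : ℝ) ^ (j + 1) - 1) ≠ 0 := fun c =>
    Finset.prod_ne_zero_iff.mpr fun j _ => two_pow_succ_sub_one_ne_zero j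
  have h := (qBinom_add_mul a b).trans (add_comm a b ▸ (qBinom_add_mul b a).symm)
  rw [mul_comm (∏ j ∈ Finset.range b, _)] at h
  exact mul_right_cancel₀ (mul_ne_zero (hne a) (hne b)) h

lemma qBinom_self (n : ℕ) : qb n n = 1 := by
  simpa using qBinom_symm n 0

/-- The `q`-Vandermonde identity. -/
lemma qBinom_vandermonde (a b r : ℕ) :
    qb (a + b) r =
      ∑ p ∈ Finset.HasAntidiagonal.antidiagonal r, qb a p.1 * qb b p.2 * 2 ^ ((a - p.1) * p.2) := by
  induction a generalizing r with
  | zero =>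
    rw [Finset.sum_eq_single (0, r)]
    · simp
    · rintro ⟨k, j⟩ hp hne
      have hk : 0 < k := Nat.pos_of_ne_zero fun h => hne (by
        have := Finset.HasAntidiagonal.mem_antidiagonal.1 hp
        subst h; simpa using this)
      simp [qBinom_eq_zero hk]
    · simp
  | succ a ih =>
    cases r with
    | zero => simp
    | succ r =>
      rw [show a + 1 + b = a + b + 1 by omega, qBinom_pascal, ih r, ih (r + 1),
        Finset.Nat.sum_antidiagonal_succ, Finset.Nat.sum_antidiagonal_succ, mul_add,
        Finset.mul_sum, add_left_comm, ← Finset.sum_add_distrib]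
      congr 1
      · simp only [qBinom_zero_right, Nat.sub_zero, one_mul]
        rw [mul_left_comm, ← pow_add]
        congr 2
        ring
      · refine Finset.sum_congr rfl fun p hp => ?_
        have hp := Finset.HasAntidiagonal.mem_antidiagonal.1 hp
        rw [qBinom_pascal a p.1, Nat.add_sub_add_right, ← hp]
        rcases le_or_gt (p.1 + 1) a with hk | hk
        · obtain ⟨c, rfl⟩ := Nat.exists_eq_add_of_le hk
          rw [show p.1 + 1 + c - p.1 = c + 1 by omega, Nat.add_sub_cancel_left]
          ring
        · rw [qBinom_eq_zero hk]
          ring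

/-- Splitting one factor by Pascal's rule turns the sum into two Vandermonde sums, which are equal
by symmetry. -/
lemma sum_sq_qBinom (m : ℕ) :
    (∑ k ∈ Finset.range (m + 1), 2 ^ (k ^ 2) * qb m k ^ 2 * (1 / 2) ^ k) * (2 ^ m + 1) =
      2 * qb (2 * m) m := by
  cases m with
  | zero => norm_num
  | succ p =>
    have h1 := qBinom_vandermonde (p + 1) p p
    have h2 := qBinom_vandermonde (p + 1) p (p + 1)
    have hS : (∑ k ∈ Finset.range (p + 1 + 1), 2 ^ (k ^ 2) * qb (p + 1) k ^ 2 * (1 / 2) ^ k) =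
        qb (p + 1 + p) p + qb (p + 1 + p) (p + 1) := by
      rw [← Finset.Nat.sum_antidiagonal_eq_sum_range_succ_mk
        (fun x : ℕ × ℕ => (2 : ℝ) ^ (x.1 ^ 2) * qb (p + 1) x.1 ^ 2 * (1 / 2) ^ x.1),
        Finset.Nat.sum_antidiagonal_succ, h1, h2, Finset.Nat.sum_antidiagonal_succ',
        add_left_comm, ← Finset.sum_add_distrib]
      congr 1
      · simp [qBinom_self]
      · rw [← Finset.Nat.sum_antidiagonal_swap]
        refine Finset.sum_congr rfl fun x hx => ?_
        have hx := Finset.HasAntidiagonal.mem_antidiagonal.1 hx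
        have hsymm : qb (p + 1) x.1 = qb (p + 1) (x.2 + 1) := by
          rw [← hx, add_assoc, qBinom_symm]
        have hpow : (2 : ℝ) ^ ((x.2 + 1) ^ 2) * (1 / 2) ^ (x.2 + 1) = 2 ^ ((x.2 + 1) * x.2) := by
          rw [show (x.2 + 1) ^ 2 = (x.2 + 1) * x.2 + (x.2 + 1) by ring, pow_add, mul_assoc,
            ← mul_pow]
          norm_num
        rw [Prod.fst_swap, mul_right_comm, hpow, hsymm, show p + 1 - x.1 = x.2 + 1 by omega]
        nth_rw 1 [pow_two]
        nth_rw 2 [qBinom_pascal]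
        ring
    have h3 := qBinom_succ_succ_mul (p + 1 + p) p
    have h4 := qBinom_symm p (p + 1)
    rw [show p + (p + 1) = p + 1 + p by omega] at h4
    rw [show p + 1 + p + 1 = 2 * (p + 1) by omega,
      show (2 : ℝ) ^ (2 * (p + 1)) - 1 = (2 ^ (p + 1) + 1) * (2 ^ (p + 1) - 1) by ring,
      ← mul_assoc] at h3
    have h5 := mul_right_cancel₀ (two_pow_succ_sub_one_ne_zero p) h3
    rw [hS, ← h4, h5]
    ring

lemma qBinom_two_mul_ne_zero (m : ℕ) : qb (2 * m) m ≠ 0 := by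
  intro h
  have h2 := qBinom_add_mul m m
  rw [← two_mul, h, zero_mul, eq_comm, Finset.prod_eq_zero_iff] at h2
  obtain ⟨j, -, hj⟩ := h2
  exact two_pow_succ_sub_one_ne_zero j hj

/-- A closed form of the optimal winning probability. -/
lemma optimalValue_eq (m : ℕ) : optimalValue m = 2 / (2 ^ m + 1) := by
  have h := sum_sq_qBinom m
  have h0 := qBinom_two_mul_ne_zero m
  rw [optimalValue, eq_div_iff (by positivity), mul_assoc, h]
  field_simp

end QBinom

lemma isTheta_optimalValue :
    Asymptotics.IsTheta Filter.atTop optimalValue (fun m : ℕ => 1 / (2 : ℝ) ^ m) := by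
  constructor
  · refine Asymptotics.IsBigO.of_bound 2 (Filter.Eventually.of_forall fun m => ?_)
    rw [optimalValue_eq, Real.norm_of_nonneg (by positivity), Real.norm_of_nonneg (by positivity),
      mul_one_div]
    gcongr
    linarith
  · refine Asymptotics.IsBigO.of_bound 1 (Filter.Eventually.of_forall fun m => ?_)
    rw [optimalValue_eq, Real.norm_of_nonneg (by positivity), Real.norm_of_nonneg (by positivity),
      one_mul, div_le_div_iff₀ (by positivity) (by positivity)]
    have : (1 : ℝ) ≤ 2 ^ m := one_le_pow₀ one_le_two
    linarith

/-! ### The explicit strategy -/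

noncomputable section Strategy

/-- The vector `|+i⟩` or `|-i⟩`, for the bits `0` and `1`. -/
def phaseVec (b : ZMod 2) : ZMod 2 → ℂ := if b = 0 then plusI else minusI

lemma phaseVec_zero_zero : phaseVec 0 0 = ((1 / Real.sqrt 2 : ℝ) : ℂ) := by
  simp [phaseVec, plusI]

lemma phaseVec_zero_one : phaseVec 0 1 = ((1 / Real.sqrt 2 : ℝ) : ℂ) * Complex.I := by
  simp [phaseVec, plusI]

lemma phaseVec_one_zero : phaseVec 1 0 = ((1 / Real.sqrt 2 : ℝ) : ℂ) := by
  simp [phaseVec, minusI]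

lemma phaseVec_one_one : phaseVec 1 1 = -(((1 / Real.sqrt 2 : ℝ) : ℂ) * Complex.I) := by
  simp [phaseVec, minusI]

lemma sum_proj_phaseVec : proj (phaseVec 0) + proj (phaseVec 1) = 1 := by
  have h := sqrt_two_inv_sq
  ext a b
  simp only [Matrix.add_apply, proj, Matrix.vecMulVec_apply, Pi.star_apply]
  revert a b
  refine forall_zmod_two (forall_zmod_two ?_ ?_) (forall_zmod_two ?_ ?_) <;>
    simp only [phaseVec_zero_zero, phaseVec_zero_one, phaseVec_one_zero, phaseVec_one_one,
      Complex.star_def, map_neg, map_mul, Complex.conj_ofReal, Complex.conj_I,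
      Matrix.one_apply_eq, Matrix.one_apply_ne (zero_ne_one (α := ZMod 2)),
      Matrix.one_apply_ne (one_ne_zero (α := ZMod 2))]
  · linear_combination 2 * h
  · ring
  · ring
  · linear_combination (-2 * Complex.I ^ 2) * h - Complex.I_sq

lemma sum_proj_single : proj (Pi.single (0 : ZMod 2) (1 : ℂ)) + proj (Pi.single 1 1) = 1 := by
  ext a b
  simp only [Matrix.add_apply, proj, Matrix.vecMulVec_apply, Pi.star_apply]
  revert a b
  refine forall_zmod_two (forall_zmod_two ?_ ?_) (forall_zmod_two ?_ ?_) <;> simp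

/-- On a Bell pair with phase bit `a` and shift bit `b`, a player who guesses `b` and one who
guesses `a` are both right with probability `1/2`. -/
lemma normSq_bell_amplitude (a b : ZMod 2) :
    Complex.normSq (∑ s, star (phaseVec b s) * hadamardMatrix s a *
      star (phaseVec (a + 1) (b + s))) = 1 / 2 := by
  have h : Complex.normSq ((1 / Real.sqrt 2 : ℝ) : ℂ) = 1 / 2 := by
    rw [Complex.normSq_ofReal, div_mul_div_comm, Real.mul_self_sqrt zero_le_two, one_mul]
  have key : ∃ u : ℂ, Complex.normSq u = 4 ∧ ∑ s, star (phaseVec b s) * hadamardMatrix s a *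
      star (phaseVec (a + 1) (b + s)) = ((1 / Real.sqrt 2 : ℝ) : ℂ) * ((1 / Real.sqrt 2 : ℝ) : ℂ) *
        ((1 / Real.sqrt 2 : ℝ) : ℂ) * u := by
    have h11 : (1 : ZMod 2) + 1 = 0 := by decide
    rw [sum_zmod_two]
    generalize hr : ((1 / Real.sqrt 2 : ℝ) : ℂ) = r
    have hstar : (starRingEnd ℂ) r = r := by rw [← hr, Complex.conj_ofReal]
    revert a b
    refine forall_zmod_two (forall_zmod_two ⟨2, ?_, ?_⟩ ⟨2 * Complex.I, ?_, ?_⟩)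
      (forall_zmod_two ⟨2, ?_, ?_⟩ ⟨-2 * Complex.I, ?_, ?_⟩)
    all_goals try rw [Complex.normSq_apply]; norm_num
    all_goals
      simp only [zero_add, add_zero, h11, phaseVec_zero_zero, phaseVec_zero_one,
        phaseVec_one_zero, phaseVec_one_one, hadamardMatrix, Matrix.of_apply, mul_zero,
        mul_one, sgn_zero, sgn_one, Complex.star_def, map_neg, map_mul, hr, hstar,
        Complex.conj_I]
    all_goals first
      | linear_combination (-r ^ 3) * Complex.I_sq
      | ring
  obtain ⟨u, hu, hs⟩ := key
  rw [hs, map_mul, map_mul, map_mul, h, hu]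
  norm_num

end Strategy

noncomputable section ProductMeasurement

variable {n ℓ : ℕ}

open Classical in
/-- Splitting a product into the factors at the pairs `(c t, d t)` and the others. -/
lemma prod_eq_prod_pairs_mul {M : Type*} [CommMonoid M] {c d : Fin ℓ → Fin n}
    (hc : Function.Injective c) (hd : Function.Injective d) (hcd : ∀ s t, c s ≠ d t)
    (F : Fin n → M) :
    ∏ i, F i = (∏ t, F (c t) * F (d t)) *
      ∏ i with i ∉ Set.range c ∧ i ∉ Set.range d, F i := by
  have hdisj : Disjoint (Finset.univ.image c) (Finset.univ.image d) := by
    rw [Finset.disjoint_left]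
    intro i hi hi'
    obtain ⟨s, -, rfl⟩ := Finset.mem_image.1 hi
    obtain ⟨t, -, ht⟩ := Finset.mem_image.1 hi'
    exact hcd s t ht.symm
  rw [Finset.prod_mul_distrib, ← Finset.prod_image (f := F) (g := c) fun _ _ _ _ h => hc h,
    ← Finset.prod_image (f := F) (g := d) fun _ _ _ _ h => hd h, ← Finset.prod_union hdisj,
    ← Finset.prod_mul_prod_compl (Finset.univ.image c ∪ Finset.univ.image d)]
  congr 1
  refine Finset.prod_congr ?_ fun _ _ => rfl
  ext i
  simp

open Classical in
/-- The amplitude of a product vector in a state of Bell pairs and basis qubits. -/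
lemma dotProduct_bell_state {c d : Fin ℓ → Fin n} (hc : Function.Injective c)
    (hd : Function.Injective d) (hcd : ∀ s t, c s ≠ d t) (β : Fin n → ZMod 2 → ℂ) (y : Bits n) :
    star (fun v : Bits n => ∏ i, β i (v i)) ⬝ᵥ
      ((List.ofFn fun t => cnot (c t) (d t) * hadamard (c t)).prod *ᵥ ket y) =
    (∏ t, ∑ s, star (β (c t) s) * hadamardMatrix s (y (c t)) * star (β (d t) (y (d t) + s))) *
      ∏ i with i ∉ Set.range c ∧ i ∉ Set.range d, star (β i (y i)) := by
  have hinv := cnotsMap_cnotsMap hcd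
  let e : Bits n ≃ Bits n := ⟨cnotsMap c d, cnotsMap c d, hinv, hinv⟩
  have hκ : ∀ w : Bits n, (∀ i ∉ Set.range d, cnotsMap c d w i = w i) ∧
      ∀ t, cnotsMap c d w (d t) = w (d t) + w (c t) := by
    intro w
    constructor
    · intro i hi
      rw [cnotsMap, Finset.sum_eq_zero fun t _ => if_neg fun h => hi ⟨t, h⟩, add_zero]
    · intro t
      rw [cnotsMap, Finset.sum_eq_single t, if_pos rfl]
      · exact fun s _ hs => if_neg fun h => hs (hd h)
      · simp
  have hcd' : ∀ t, c t ∉ Set.range d := fun t ⟨s, hs⟩ => hcd t s hs.symm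
  have hdc' : ∀ t, d t ∉ Set.range c := fun t ⟨s, hs⟩ => hcd s t hs
  rw [(prod_cnot_mul_hadamard c d hc hcd).1, ← Matrix.mulVec_mulVec, mulVec_ket, dotProduct,
    ← e.sum_comp]
  -- The one-qubit factors of the summands.
  let a : Fin n → ZMod 2 → ℂ := fun i s =>
    if h : ∃ t, c t = i then star (β i s) * hadamardMatrix s (y i) *
      star (β (d h.choose) (y (d h.choose) + s))
    else if i ∈ Set.range d then (if s = y i then 1 else 0)
    else star (β i s) * (if s = y i then 1 else 0)
  have ha_c : ∀ t s, a (c t) s = star (β (c t) s) * hadamardMatrix s (y (c t)) *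
      star (β (d t) (y (d t) + s)) := by
    intro t s
    have hex : ∃ t', c t' = c t := ⟨t, rfl⟩
    have : hex.choose = t := hc hex.choose_spec
    simp only [a, dif_pos hex, this]
  have ha_d : ∀ t s, a (d t) s = if s = y (d t) then 1 else 0 := by
    intro t s
    have hne : ¬∃ t', c t' = d t := hdc' t
    simp only [a, dif_neg hne, if_pos (Set.mem_range_self t)]
  have ha_o : ∀ i, i ∉ Set.range c ∧ i ∉ Set.range d → ∀ s,
      a i s = star (β i s) * (if s = y i then 1 else 0) := by
    intro i hi s
    have hne : ¬∃ t', c t' = i := hi.1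
    simp only [a, dif_neg hne, if_neg hi.2]
  have hterm : ∀ w : Bits n, star (fun v : Bits n => ∏ i, β i (v i)) (e w) *
      (permOp (cnotsMap c d) *ᵥ fun v => hadamardOn (Finset.univ.image c) v y) (e w) =
        ∏ i, a i (w i) := by
    intro w
    rw [permOp_mulVec_apply _ _ hinv hinv]
    change star (∏ i, β i (cnotsMap c d w i)) *
      hadamardOn (Finset.univ.image c) (cnotsMap c d (cnotsMap c d w)) y = _
    rw [hinv, star_prod, hadamardOn, tensorAll, Matrix.of_apply, ← Finset.prod_mul_distrib,
      prod_eq_prod_pairs_mul hc hd hcd, prod_eq_prod_pairs_mul hc hd hcd (fun i => a i (w i))]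
    congr 1
    · refine Finset.prod_congr rfl fun t _ => ?_
      rw [ha_c, ha_d, (hκ w).2, (hκ w).1 _ (hcd' t), if_pos (by simp),
        if_neg (by simpa using fun s => hcd s t), Matrix.one_apply]
      split_ifs with h
      · rw [h, mul_one, mul_one]
      · rw [mul_zero, mul_zero, mul_zero]
    · refine Finset.prod_congr rfl fun i hi => ?_
      have hi := (Finset.mem_filter.1 hi).2
      rw [ha_o i hi, (hκ w).1 _ hi.2, if_neg (by simpa using hi.1), Matrix.one_apply]
  rw [Finset.sum_congr rfl fun w _ => hterm w, ← Fintype.prod_sum,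
    prod_eq_prod_pairs_mul hc hd hcd]
  congr 1
  · refine Finset.prod_congr rfl fun t _ => ?_
    simp [ha_c, ha_d]
  · refine Finset.prod_congr rfl fun i hi => ?_
    simp [ha_o i (Finset.mem_filter.1 hi).2]

/-- The expectation of a rank one projection. -/
lemma dotProduct_proj_mulVec {α : Type} [Fintype α] (β φ : α → ℂ) :
    (star φ ⬝ᵥ (proj β *ᵥ φ)).re = Complex.normSq (star β ⬝ᵥ φ) := by
  have h : star φ ⬝ᵥ (proj β *ᵥ φ) = (star φ ⬝ᵥ β) * (star β ⬝ᵥ φ) := by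
    rw [proj, Matrix.vecMulVec_mulVec]
    simp [dotProduct_smul, mul_comm]
  have h2 : star φ ⬝ᵥ β = star (star β ⬝ᵥ φ) := by
    rw [Matrix.star_dotProduct]
  rw [h, h2, Complex.star_def, mul_comm, Complex.mul_conj, Complex.ofReal_re]

end ProductMeasurement

/-! ### Winning probability of the explicit strategy -/

noncomputable section ExplicitStrategy

variable {m : ℕ} {W : Grass m}

/-- A sum over the vectors supported on the range of an injection is a sum over all bit strings. -/
lemma sum_supported {n k : ℕ} {M : Type*} [AddCommMonoid M] {σ : Fin k → Fin n}
    (hσ : Function.Injective σ) {S : Finset (Bits n)}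
    (hS : ∀ x, x ∈ S ↔ ∀ i ∉ Set.range σ, x i = 0) (F : Bits k → M) :
    ∑ x ∈ S, F (fun i => x (σ i)) = ∑ y, F y := by
  refine Finset.sum_bij (fun x _ i => x (σ i)) (fun _ _ => Finset.mem_univ _) ?_ ?_
    fun _ _ => rfl
  · intro x hx x' hx' h
    funext i
    by_cases hi : i ∈ Set.range σ
    · obtain ⟨j, rfl⟩ := hi
      exact congrFun h j
    · rw [(hS x).1 hx i hi, (hS x').1 hx' i hi]
  · intro y _
    refine ⟨Function.extend σ y 0, (hS _).2 fun i hi => ?_, ?_⟩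
    · exact Function.extend_apply' _ _ _ hi
    · funext i
      exact hσ.extend_apply _ _ _

/-- Reindexing a sum by an injective self-map of the index set. -/
lemma sum_comp_of_injective {α M : Type*} [AddCommMonoid M] {s : Finset α} {g : α → α}
    (hg : Function.Injective g) (hs : ∀ x ∈ s, g x ∈ s) (F : α → M) :
    ∑ x ∈ s, F (g x) = ∑ x ∈ s, F x := by
  classical
  rw [← Finset.sum_image (f := F) fun _ _ _ _ h => hg h]
  congr 1
  refine Finset.eq_of_subset_of_card_le (Finset.image_subset_iff.mpr hs) ?_
  rw [Finset.card_image_of_injective _ hg]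

namespace Reduction

lemma f_injective (R : Reduction W) : Function.Injective R.f := by
  intro v w h
  have h1 : R.f₁ (bobPart v) = R.f₁ (bobPart w) := by
    simpa [f, pairMap] using congrArg bobPart h
  have h2 : R.f₂ (charliePart v) = R.f₂ (charliePart w) := by
    simpa [f, pairMap] using congrArg charliePart h
  rw [← append_parts v, ← append_parts w, R.f₁.injective h1, R.f₂.injective h2]

lemma f_add (R : Reduction W) (v w : Bits (m + m)) : R.f (v + w) = R.f v + R.f w := by
  rw [← append_parts (R.f v + R.f w)]
  change Fin.append (R.f₁ (bobPart v + bobPart w)) (R.f₂ (charliePart v + charliePart w)) =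
    Fin.append (bobPart (R.f v) + bobPart (R.f w)) (charliePart (R.f v) + charliePart (R.f w))
  simp [f, pairMap]

lemma bobIdx_ne_charlieIdx (R : Reduction W) (s t : Fin R.ell) :
    Fin.castAdd m (R.bobIdx s) ≠ Fin.natAdd m (R.charlieIdx t) := fun h =>
  R.charlieIdx_notMem t (h ▸ R.bobIdx_mem s)

open Classical in
/-- The bit of `y_B` that determines Bob's measurement on his `i`-th qubit. -/
def bobBit (R : Reduction W) (h : R.Matching) (i : Fin m) : Fin (m + m) :=
  if ht : ∃ t, R.bobIdx t = i then Fin.natAdd m (R.charlieIdx ht.choose)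
  else if hi : Fin.castAdd m i ∈ pivots W.1 then Fin.natAdd m (h ⟨i, hi, ht⟩).1
  else Fin.castAdd m i

open Classical in
/-- The bit of `y_C` that determines Charlie's measurement on his `j`-th qubit. -/
def charlieBit (R : Reduction W) (h : R.Matching) (j : Fin m) : Fin (m + m) :=
  if ht : ∃ t, R.charlieIdx t = j then Fin.castAdd m (R.bobIdx ht.choose)
  else if hj : Fin.natAdd m j ∉ pivots W.1 then Fin.castAdd m (h.symm ⟨j, hj, ht⟩).1
  else Fin.natAdd m j

variable (R : Reduction W) (h : R.Matching)

lemma bobBit_bobIdx (t : Fin R.ell) :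
    R.bobBit h (R.bobIdx t) = Fin.natAdd m (R.charlieIdx t) := by
  have ht : ∃ t', R.bobIdx t' = R.bobIdx t := ⟨t, rfl⟩
  rw [bobBit, dif_pos ht, R.bobIdx_injective ht.choose_spec]

lemma bobBit_matched (i : {i : Fin m // Fin.castAdd m i ∈ pivots W.1 ∧ i ∉ Set.range R.bobIdx}) :
    R.bobBit h i.1 = Fin.natAdd m (h i).1 := by
  have ht : ¬∃ t', R.bobIdx t' = i.1 := i.2.2
  rw [bobBit, dif_neg ht, dif_pos i.2.1]

lemma bobBit_of_notMem {i : Fin m} (hi : Fin.castAdd m i ∉ pivots W.1) :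
    R.bobBit h i = Fin.castAdd m i := by
  have ht : ¬∃ t', R.bobIdx t' = i := fun ⟨t, ht⟩ => hi (ht ▸ R.bobIdx_mem t)
  rw [bobBit, dif_neg ht, dif_neg hi]

lemma charlieBit_charlieIdx (t : Fin R.ell) :
    R.charlieBit h (R.charlieIdx t) = Fin.castAdd m (R.bobIdx t) := by
  have ht : ∃ t', R.charlieIdx t' = R.charlieIdx t := ⟨t, rfl⟩
  rw [charlieBit, dif_pos ht, R.charlieIdx_injective ht.choose_spec]

lemma charlieBit_matched
    (j : {j : Fin m // Fin.natAdd m j ∉ pivots W.1 ∧ j ∉ Set.range R.charlieIdx}) :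
    R.charlieBit h j.1 = Fin.castAdd m (h.symm j).1 := by
  have ht : ¬∃ t', R.charlieIdx t' = j.1 := j.2.2
  rw [charlieBit, dif_neg ht, dif_pos j.2.1]

lemma charlieBit_of_mem {j : Fin m} (hj : Fin.natAdd m j ∈ pivots W.1) :
    R.charlieBit h j = Fin.natAdd m j := by
  have ht : ¬∃ t', R.charlieIdx t' = j := fun ⟨t, ht⟩ => R.charlieIdx_notMem t (ht ▸ hj)
  rw [charlieBit, dif_neg ht, dif_neg (not_not.mpr hj)]

/-- Every qubit of Bob belongs to a Bell pair, or is a matched pivot, or is not a pivot. -/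
lemma bob_cases {p : Fin m → Prop} (h1 : ∀ t, p (R.bobIdx t))
    (h2 : ∀ i : {i : Fin m // Fin.castAdd m i ∈ pivots W.1 ∧ i ∉ Set.range R.bobIdx}, p i.1)
    (h3 : ∀ i, Fin.castAdd m i ∉ pivots W.1 → p i) (i : Fin m) : p i := by
  by_cases hr : i ∈ Set.range R.bobIdx
  · obtain ⟨t, rfl⟩ := hr; exact h1 t
  · by_cases hi : Fin.castAdd m i ∈ pivots W.1
    · exact h2 ⟨i, hi, hr⟩
    · exact h3 i hi

lemma charlie_cases {p : Fin m → Prop} (h1 : ∀ t, p (R.charlieIdx t))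
    (h2 : ∀ j : {j : Fin m // Fin.natAdd m j ∉ pivots W.1 ∧ j ∉ Set.range R.charlieIdx}, p j.1)
    (h3 : ∀ j, Fin.natAdd m j ∈ pivots W.1 → p j) (j : Fin m) : p j := by
  by_cases hr : j ∈ Set.range R.charlieIdx
  · obtain ⟨t, rfl⟩ := hr; exact h1 t
  · by_cases hj : Fin.natAdd m j ∈ pivots W.1
    · exact h3 j hj
    · exact h2 ⟨j, hj, hr⟩

lemma bobBit_notMem (i : Fin m) : R.bobBit h i ∉ pivots W.1 := by
  revert i
  refine R.bob_cases (fun t => ?_) (fun i => ?_) fun i hi => ?_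
  · rw [bobBit_bobIdx]; exact R.charlieIdx_notMem t
  · rw [bobBit_matched]; exact (h i).2.1
  · rw [bobBit_of_notMem _ _ hi]; exact hi

lemma charlieBit_mem (j : Fin m) : R.charlieBit h j ∈ pivots W.1 := by
  revert j
  refine R.charlie_cases (fun t => ?_) (fun j => ?_) fun j hj => ?_
  · rw [charlieBit_charlieIdx]; exact R.bobIdx_mem t
  · rw [charlieBit_matched]; exact (h.symm j).2.1
  · rw [charlieBit_of_mem _ _ hj]; exact hj

lemma range_bobBit : Set.range (R.bobBit h) = (pivots W.1)ᶜ := by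
  refine Set.Subset.antisymm (Set.range_subset_iff.mpr (R.bobBit_notMem h)) fun k => ?_
  refine Fin.addCases (fun i hi => ⟨i, R.bobBit_of_notMem h hi⟩) (fun j => ?_) k
  revert j
  refine R.charlie_cases (fun t _ => ⟨_, R.bobBit_bobIdx h t⟩) (fun j _ => ⟨(h.symm j).1, ?_⟩)
    fun j hj hj' => absurd hj hj'
  rw [bobBit_matched, Equiv.apply_symm_apply]

lemma range_charlieBit : Set.range (R.charlieBit h) = pivots W.1 := by
  refine Set.Subset.antisymm (Set.range_subset_iff.mpr (R.charlieBit_mem h)) fun k => ?_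
  refine Fin.addCases (fun i => ?_) (fun j hj => ⟨j, R.charlieBit_of_mem h hj⟩) k
  revert i
  refine R.bob_cases (fun t _ => ⟨_, R.charlieBit_charlieIdx h t⟩) (fun i _ => ⟨(h i).1, ?_⟩)
    fun i hi hi' => absurd hi' hi
  rw [charlieBit_matched, Equiv.symm_apply_apply]

lemma injective_of_card_range {n k : ℕ} {σ : Fin k → Fin n} [DecidablePred (· ∈ Set.range σ)]
    (h : (Finset.univ.filter (· ∈ Set.range σ)).card = k) : Function.Injective σ := by
  rw [← Set.injOn_univ, ← Finset.coe_univ, ← Finset.card_image_iff, Finset.card_univ,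
    Fintype.card_fin]
  refine Eq.trans ?_ h
  congr 1
  ext i
  simp

lemma bobBit_injective : Function.Injective (R.bobBit h) := by
  classical
  refine injective_of_card_range ?_
  simp only [R.range_bobBit h]
  convert card_not_pivots_grass W

lemma charlieBit_injective : Function.Injective (R.charlieBit h) := by
  classical
  refine injective_of_card_range ?_
  simp only [R.range_charlieBit h]
  convert card_pivots_grass W

open Classical in
/-- The vector onto which Bob projects his `i`-th qubit if the bit `bobBit i` of `y_B` is `b`. -/
def bobVec (i : Fin m) (b : ZMod 2) : ZMod 2 → ℂ :=
  if i ∈ Set.range R.bobIdx then phaseVec b else Pi.single b 1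

open Classical in
/-- The vector onto which Charlie projects his `j`-th qubit if the bit `charlieBit j` of `y_C`
is `b`. -/
def charlieVec (j : Fin m) (b : ZMod 2) : ZMod 2 → ℂ :=
  if j ∈ Set.range R.charlieIdx then phaseVec (b + 1) else Pi.single b 1

lemma bobQubit_eq (yB : Bits (m + m)) (i : Fin m) :
    bobQubit R h yB i = proj (R.bobVec i (yB (R.bobBit h i))) := by
  rw [bobQubit, bobBit, bobVec]
  by_cases ht : ∃ t, R.bobIdx t = i
  · have hr : i ∈ Set.range R.bobIdx := ht
    simp only [dif_pos ht, if_pos hr, phaseVec]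
    split_ifs <;> rfl
  · have hr : i ∉ Set.range R.bobIdx := ht
    simp only [dif_neg ht, if_neg hr]
    split_ifs <;> rfl

lemma charlieQubit_eq (yC : Bits (m + m)) (j : Fin m) :
    charlieQubit R h yC j = proj (R.charlieVec j (yC (R.charlieBit h j))) := by
  rw [charlieQubit, charlieBit, charlieVec]
  by_cases ht : ∃ t, R.charlieIdx t = j
  · have hr : j ∈ Set.range R.charlieIdx := ht
    have hiff : ∀ b : ZMod 2, b + 1 = 0 ↔ b = 1 := by decide
    simp only [dif_pos ht, if_pos hr, phaseVec, hiff]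
    split_ifs <;> rfl
  · have hr : j ∉ Set.range R.charlieIdx := ht
    simp only [dif_neg ht, if_neg hr]
    split_ifs <;> rfl

lemma sum_proj_bobVec (i : Fin m) : ∑ b, proj (R.bobVec i b) = 1 := by
  rw [sum_zmod_two, bobVec, bobVec]
  split_ifs
  · exact sum_proj_phaseVec
  · exact sum_proj_single

lemma sum_proj_charlieVec (j : Fin m) : ∑ b, proj (R.charlieVec j b) = 1 := by
  rw [sum_zmod_two, charlieVec, charlieVec]
  split_ifs
  · rw [add_comm, zero_add, show (1 : ZMod 2) + 1 = 0 by decide]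
    exact sum_proj_phaseVec
  · exact sum_proj_single

lemma sum_tensorAll_proj {k : ℕ} (β : Fin k → ZMod 2 → ZMod 2 → ℂ)
    (hβ : ∀ i, ∑ b, proj (β i b) = 1) :
    ∑ y : Bits k, tensorAll (fun i => proj (β i (y i))) = 1 := by
  rw [← tensorAll_one]
  ext v w
  rw [Matrix.sum_apply]
  have h1 : ∀ i, (1 : Matrix (ZMod 2) (ZMod 2) ℂ) (v i) (w i) =
      ∑ b, proj (β i b) (v i) (w i) := fun i => by rw [← hβ i, Matrix.sum_apply]
  change _ = ∏ i, (1 : Matrix (ZMod 2) (ZMod 2) ℂ) (v i) (w i)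
  rw [Finset.prod_congr rfl fun i _ => h1 i, Fintype.prod_sum]
  rfl

/-- A product measurement after a circuit is a POVM. -/
lemma isPOVM_circuit {X : Type} {S : Finset X} (L : List (Gate m)) (β : X → Fin m → ZMod 2 → ℂ)
    (hβ : ∑ x ∈ S, tensorAll (fun i => proj (β x i)) = 1) :
    IsPOVM S fun x => (circuitOp L)ᴴ * tensorAll (fun i => proj (β x i)) * circuitOp L := by
  constructor
  · intro x _
    change ((circuitOp L)ᴴ * tensorAll (fun i => proj (β x i)) * circuitOp L).PosSemidef
    rw [tensorAll_proj]
    exact (Matrix.posSemidef_vecMulVec_self_star _).conjTranspose_mul_mul_same _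
  · rw [← Finset.sum_mul, ← Finset.mul_sum, hβ, Matrix.mul_one, circuitOp_unitary]

lemma mem_canonRep_iff_bobBit (x : Bits (m + m)) :
    x ∈ canonRep m W ↔ ∀ i ∉ Set.range (R.bobBit h), x i = 0 := by
  rw [mem_canonRep, range_bobBit]
  simp

lemma mem_canonRepPerp_iff_charlieBit (z : Bits (m + m)) :
    z ∈ canonRepPerp m W ↔ ∀ i ∉ Set.range (R.charlieBit h), z i = 0 := by
  rw [mem_canonRepPerp, range_charlieBit]

lemma isPOVM_bob : IsPOVM (canonRep m W) fun x =>
    (circuitOp R.bobCircuit)ᴴ * tensorAll (bobQubit R h (R.f x)) * circuitOp R.bobCircuit := by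
  have hq : ∀ x, bobQubit R h x = fun i => proj (R.bobVec i (x (R.bobBit h i))) := fun x =>
    funext fun i => R.bobQubit_eq h x i
  simp only [hq]
  refine isPOVM_circuit _ _ ?_
  rw [sum_comp_of_injective R.f_injective R.map_canonRep fun x =>
      tensorAll fun i => proj (R.bobVec i (x (R.bobBit h i))),
    sum_supported (R.bobBit_injective h) (R.mem_canonRep_iff_bobBit h) fun y =>
      tensorAll fun i => proj (R.bobVec i (y i))]
  exact sum_tensorAll_proj _ R.sum_proj_bobVec

lemma isPOVM_charlie : IsPOVM (canonRepPerp m W) fun z =>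
    (circuitOp R.charlieCircuit)ᴴ * tensorAll (charlieQubit R h (R.f z)) *
      circuitOp R.charlieCircuit := by
  have hq : ∀ z, charlieQubit R h z =
      fun j => proj (R.charlieVec j (z (R.charlieBit h j))) := fun z =>
    funext fun j => R.charlieQubit_eq h z j
  simp only [hq]
  refine isPOVM_circuit _ _ ?_
  rw [sum_comp_of_injective R.f_injective R.map_canonRepPerp fun z =>
      tensorAll fun j => proj (R.charlieVec j (z (R.charlieBit h j))),
    sum_supported (R.charlieBit_injective h) (R.mem_canonRepPerp_iff_charlieBit h) fun y =>
      tensorAll fun j => proj (R.charlieVec j (y j))]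
  exact sum_tensorAll_proj _ R.sum_proj_charlieVec

open Classical in
/-- The matched qubits are guessed correctly if and only if the bits that Charlie is to guess at
them agree with those that Bob is to guess; the Bell pairs contribute a factor `1/2` each. -/
lemma winProb_eq (x z : Bits (m + m)) (hx : x ∈ canonRep m W) (hz : z ∈ canonRepPerp m W) :
    (Matrix.trace (localOp
      ((circuitOp R.bobCircuit)ᴴ * tensorAll (bobQubit R h (R.f x)) * circuitOp R.bobCircuit)
      ((circuitOp R.charlieCircuit)ᴴ * tensorAll (charlieQubit R h (R.f z)) *
        circuitOp R.charlieCircuit) * proj (cosetState W x z))).re =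
    (1 / 2) ^ R.ell * ∏ j, if Fin.natAdd m j ∉ pivots W.1 ∧ j ∉ Set.range R.charlieIdx then
      (if R.f z (R.charlieBit h j) = R.f x (Fin.natAdd m j) then 1 else 0) else 1 := by
  have hx' := mem_canonRep.1 (R.map_canonRep x hx)
  have hz' := mem_canonRepPerp.1 (R.map_canonRepPerp z hz)
  change ∀ i ∈ pivots W.1, R.f x i = 0 at hx'
  change ∀ i ∉ pivots W.1, R.f z i = 0 at hz'
  let β : Fin (m + m) → ZMod 2 → ℂ := Fin.append
    (fun i => R.bobVec i (R.f x (R.bobBit h i)))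
    (fun j => R.charlieVec j (R.f z (R.charlieBit h j)))
  have hβ : localOp (tensorAll (bobQubit R h (R.f x))) (tensorAll (charlieQubit R h (R.f z))) =
      proj fun v => ∏ i, β i (v i) := by
    rw [localOp_tensorAll, ← tensorAll_proj]
    congr 1
    funext i
    refine Fin.addCases (fun i => ?_) (fun j => ?_) i
    · simp only [β, Fin.append_left, bobQubit_eq]
    · simp only [β, Fin.append_right, charlieQubit_eq]
  have hyp : ∀ i ∈ pivots W.1, R.f (x + z) i = R.f z i := fun i hi => by
    rw [f_add, Pi.add_apply, hx' i hi, zero_add]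
  have hyn : ∀ i ∉ pivots W.1, R.f (x + z) i = R.f x i := fun i hi => by
    rw [f_add, Pi.add_apply, hz' i hi, add_zero]
  have hβc : ∀ t, β (Fin.castAdd m (R.bobIdx t)) =
      phaseVec (R.f (x + z) (Fin.natAdd m (R.charlieIdx t))) := fun t => by
    simp only [β, Fin.append_left, bobBit_bobIdx, bobVec, if_pos (Set.mem_range_self t),
      hyn _ (R.charlieIdx_notMem t)]
  have hβd : ∀ t, β (Fin.natAdd m (R.charlieIdx t)) =
      phaseVec (R.f (x + z) (Fin.castAdd m (R.bobIdx t)) + 1) := fun t => by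
    simp only [β, Fin.append_right, charlieBit_charlieIdx, charlieVec,
      if_pos (Set.mem_range_self t), hyp _ (R.bobIdx_mem t)]
  rw [localOp_mul, localOp_mul, ← localOp_conjTranspose, trace_mul_proj, ← Matrix.mulVec_mulVec,
    ← Matrix.mulVec_mulVec, Matrix.dotProduct_mulVec, ← Matrix.star_mulVec, R.reduces x hx z hz,
    hβ, dotProduct_proj_mulVec, dotProduct_bell_state (c := fun t => Fin.castAdd m (R.bobIdx t))
      (d := fun t => Fin.natAdd m (R.charlieIdx t))
      ((Fin.castAdd_injective m m).comp R.bobIdx_injective)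
      ((Fin.natAdd_injective m m).comp R.charlieIdx_injective) R.bobIdx_ne_charlieIdx, map_mul,
    map_prod, map_prod]
  change (∏ t, Complex.normSq (∑ s, star (β (Fin.castAdd m (R.bobIdx t)) s) *
    hadamardMatrix s (R.f (x + z) (Fin.castAdd m (R.bobIdx t))) *
    star (β (Fin.natAdd m (R.charlieIdx t))
      (R.f (x + z) (Fin.natAdd m (R.charlieIdx t)) + s)))) *
    ∏ i with _, Complex.normSq (star (β i (R.f (x + z) i))) = _
  congr 1
  · simp only [hβc, hβd, normSq_bell_amplitude, Finset.prod_const, Finset.card_univ,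
      Fintype.card_fin]
  · have hsingle : ∀ a b : ZMod 2, Complex.normSq (star ((Pi.single a 1 : ZMod 2 → ℂ) b)) =
        if a = b then 1 else 0 := by
      intro a b
      by_cases hab : a = b
      · subst hab; simp
      · simp [hab]
    have hcr : ∀ i, Fin.castAdd m i ∈ Set.range (fun t => Fin.castAdd m (R.bobIdx t)) ↔
        i ∈ Set.range R.bobIdx := fun i => by
      simp [(Fin.castAdd_injective m m).eq_iff]
    have hdr : ∀ j, Fin.natAdd m j ∈ Set.range (fun t => Fin.natAdd m (R.charlieIdx t)) ↔
        j ∈ Set.range R.charlieIdx := fun j => by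
      simp only [Set.mem_range, (Fin.natAdd_injective m m).eq_iff]
    have hne : ∀ i j, Fin.castAdd m i ≠ Fin.natAdd m j := fun i j h => by
      have := congrArg Fin.val h
      simp only [Fin.val_castAdd, Fin.val_natAdd] at this
      omega
    have hcn : ∀ i, Fin.castAdd m i ∉ Set.range (fun t => Fin.natAdd m (R.charlieIdx t)) :=
      fun i ⟨t, ht⟩ => hne _ _ ht.symm
    have hdn : ∀ j, Fin.natAdd m j ∉ Set.range (fun t => Fin.castAdd m (R.bobIdx t)) :=
      fun i ⟨t, ht⟩ => hne _ _ ht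
    -- Bob's half: only the matched pivots matter, and they give the same conditions as Charlie's.
    have hbob : ∀ i, i ∉ Set.range R.bobIdx → Complex.normSq (star (β (Fin.castAdd m i)
        (R.f (x + z) (Fin.castAdd m i)))) =
          if R.f x (R.bobBit h i) = R.f (x + z) (Fin.castAdd m i) then 1 else 0 := by
      intro i hi
      simp only [β, Fin.append_left, bobVec, if_neg hi, hsingle]
    have hcharlie : ∀ j, j ∉ Set.range R.charlieIdx → Complex.normSq (star (β (Fin.natAdd m j)
        (R.f (x + z) (Fin.natAdd m j)))) =
          if R.f z (R.charlieBit h j) = R.f (x + z) (Fin.natAdd m j) then 1 else 0 := by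
      intro j hj
      simp only [β, Fin.append_right, charlieVec, if_neg hj, hsingle]
    rw [Finset.prod_filter, Fin.prod_univ_add]
    simp only [hcr, hdr, hcn, hdn, not_false_eq_true, and_true, true_and]
    have hrhs : ∀ j, (if j ∉ Set.range R.charlieIdx then Complex.normSq (star (β (Fin.natAdd m j)
        (R.f (x + z) (Fin.natAdd m j)))) else 1) =
        if Fin.natAdd m j ∉ pivots W.1 ∧ j ∉ Set.range R.charlieIdx then
          (if R.f z (R.charlieBit h j) = R.f x (Fin.natAdd m j) then (1 : ℝ) else 0) else 1 := by
      intro j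
      by_cases hj : j ∈ Set.range R.charlieIdx
      · simp only [hj, not_true_eq_false, if_false, and_false]
      · by_cases hp : Fin.natAdd m j ∈ pivots W.1
        · rw [if_pos hj, if_neg fun hc => hc.1 hp, hcharlie j hj, R.charlieBit_of_mem h hp,
            hyp _ hp, if_pos rfl]
        · rw [if_pos hj, if_pos ⟨hp, hj⟩, hcharlie j hj, hyn _ hp]
    rw [Finset.prod_congr rfl fun j _ => hrhs j]
    by_cases hall : ∀ j : {j : Fin m // Fin.natAdd m j ∉ pivots W.1 ∧ j ∉ Set.range R.charlieIdx},
        R.f z (R.charlieBit h j) = R.f x (Fin.natAdd m j)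
    · rw [Finset.prod_eq_one, one_mul]
      suffices hone : ∀ i, (if i ∉ Set.range R.bobIdx then Complex.normSq (star
          (β (Fin.castAdd m i) (R.f (x + z) (Fin.castAdd m i)))) else 1) = 1 from
        fun i _ => hone i
      refine R.bob_cases (fun t => ?_) (fun i => ?_) fun i hi => ?_
      · rw [if_neg (not_not.mpr (Set.mem_range_self t))]
      · rw [if_pos i.2.2, hbob _ i.2.2, if_pos]
        have := hall (h i)
        rw [charlieBit_matched, Equiv.symm_apply_apply] at this
        rw [bobBit_matched, hyp _ i.2.1, this]
      · by_cases hr : i ∈ Set.range R.bobIdx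
        · rw [if_neg (not_not.mpr hr)]
        · rw [if_pos hr, hbob i hr, bobBit_of_notMem _ _ hi, hyn _ hi, if_pos rfl]
    · push Not at hall
      obtain ⟨j, hj⟩ := hall
      rw [Finset.prod_eq_zero (i := j.1) (s := Finset.univ) (f := fun j : Fin m =>
        if Fin.natAdd m j ∉ pivots W.1 ∧ j ∉ Set.range R.charlieIdx then
          (if R.f z (R.charlieBit h j) = R.f x (Fin.natAdd m j) then (1 : ℝ) else 0) else 1)
        (Finset.mem_univ _) (by rw [if_pos j.2, if_neg hj]), mul_zero]

end Reduction

/-- For each `W` the explicit strategy wins with probability `2^{-k}`. -/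
lemma winProbAt_explicit (R : ∀ W : Grass m, Reduction W) (h : ∀ W, (R W).Matching) (W : Grass m) :
    winProbAt (canonRep m) (canonRepPerp m) (bobStrategy R h) (charlieStrategy R h) W =
      (1 / 2) ^ bobDim W := by
  classical
  let P : Fin m → Prop := fun j => Fin.natAdd m j ∉ pivots W.1 ∧ j ∉ Set.range (R W).charlieIdx
  have hz : ∀ x : Bits (m + m), ∑ z ∈ canonRepPerp m W, ∏ j, (if P j then
      (if (R W).f z ((R W).charlieBit (h W) j) = x (Fin.natAdd m j) then (1 : ℝ) else 0) else 1) =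
        2 ^ (Finset.univ.filter fun j => ¬P j).card := by
    intro x
    rw [sum_comp_of_injective (R W).f_injective (R W).map_canonRepPerp fun z => ∏ j, (if P j then
        (if z ((R W).charlieBit (h W) j) = x (Fin.natAdd m j) then (1 : ℝ) else 0) else 1),
      sum_supported ((R W).charlieBit_injective (h W))
        ((R W).mem_canonRepPerp_iff_charlieBit (h W)) fun y => ∏ j, (if P j then
          (if y j = x (Fin.natAdd m j) then (1 : ℝ) else 0) else 1),
      ← Fintype.prod_sum fun j b => if P j then
          (if b = x (Fin.natAdd m j) then (1 : ℝ) else 0) else 1,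
      ← Finset.prod_const, Finset.prod_filter]
    refine Finset.prod_congr rfl fun j _ => ?_
    by_cases hj : P j
    · simp [hj]
    · simp [hj, ZMod.card]
  have hcard := Finset.card_filter_add_card_filter_not (s := Finset.univ) P
  have hcard2 := card_and_notMem_range_add (fun j => Fin.natAdd m j ∉ pivots W.1) _
    (R W).charlieIdx_injective (R W).charlieIdx_notMem
  have hcard3 := card_charlie_not_pivots W
  have hxz : ∀ x ∈ canonRep m W, ∀ z ∈ canonRepPerp m W,
      winProbXZ (bobStrategy R h) (charlieStrategy R h) W x z = (1 / 2) ^ (R W).ell *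
        ∏ j, if P j then (if (R W).f z ((R W).charlieBit (h W) j) =
          (R W).f x (Fin.natAdd m j) then 1 else 0) else 1 :=
    fun x hx z hz => (R W).winProb_eq (h W) x z hx hz
  rw [winProbAt, Finset.sum_congr rfl fun x hx => Finset.sum_congr rfl fun z hz' =>
    hxz x hx z hz']
  simp only [← Finset.mul_sum]
  rw [Finset.sum_congr rfl fun x _ => hz ((R W).f x), Finset.sum_const, card_canonRep,
    card_canonRepPerp]
  have hk : (Finset.univ.filter fun j => ¬P j).card + bobDim W = (R W).ell + m := by
    rw [Finset.card_univ, Fintype.card_fin] at hcard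
    have : (Finset.univ.filter P).card + (R W).ell = bobDim W := by
      rw [← hcard3]; convert hcard2
    omega
  have hpow : (2 : ℝ) ^ (Finset.univ.filter fun j => ¬P j).card * 2 ^ bobDim W =
      2 ^ (R W).ell * 2 ^ m := by rw [← pow_add, hk, pow_add]
  rw [one_div, inv_pow, inv_pow, nsmul_eq_mul, div_eq_iff (by positivity)]
  push_cast
  field_simp
  linear_combination hpow

lemma isStrategy_explicit (R : ∀ W : Grass m, Reduction W) (h : ∀ W, (R W).Matching) :
    IsStrategy (canonRep m) (canonRepPerp m) (bobStrategy R h) (charlieStrategy R h) :=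
  fun W => ⟨(R W).isPOVM_bob (h W), (R W).isPOVM_charlie (h W)⟩

end ExplicitStrategy

/-! ### Reduction to Bell pairs -/

noncomputable section BlockMap

variable {m : ℕ} (p : Fin m → Prop) [DecidablePred p]

/-- The map given by the matrix `N` on the coordinates with `p` and by the identity on the
others. -/
def blockMap (N : Matrix {i // p i} {i // p i} (ZMod 2)) : Bits m →ₗ[ZMod 2] Bits m where
  toFun v i := if h : p i then (N *ᵥ fun k => v k.1) ⟨i, h⟩ else v i
  map_add' u v := by
    funext i
    by_cases h : p i
    · have : (fun k : {i // p i} => (u + v) k.1) = (fun k => u k.1) + fun k => v k.1 := rfl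
      simp only [dif_pos h, this, Matrix.mulVec_add]
      simp only [Pi.add_apply, dif_pos h]
    · simp only [dif_neg h, Pi.add_apply]
  map_smul' c v := by
    funext i
    by_cases h : p i
    · have : (fun k : {i // p i} => (c • v) k.1) = c • fun k => v k.1 := rfl
      simp only [dif_pos h, this, Matrix.mulVec_smul, RingHom.id_apply]
      simp only [Pi.smul_apply, dif_pos h]
    · simp only [dif_neg h, Pi.smul_apply, RingHom.id_apply]

variable {p}

lemma blockMap_apply_sub (N : Matrix {i // p i} {i // p i} (ZMod 2)) (v : Bits m)
    (i : {i // p i}) : blockMap p N v i.1 = (N *ᵥ fun k => v k.1) i := by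
  simp only [blockMap, LinearMap.coe_mk, AddHom.coe_mk, dif_pos i.2]

lemma blockMap_apply_of_not (N : Matrix {i // p i} {i // p i} (ZMod 2)) (v : Bits m)
    {i : Fin m} (hi : ¬p i) : blockMap p N v i = v i := by
  simp only [blockMap, LinearMap.coe_mk, AddHom.coe_mk, dif_neg hi]

lemma blockMap_blockMap {N N' : Matrix {i // p i} {i // p i} (ZMod 2)} (h : N * N' = 1)
    (v : Bits m) : blockMap p N (blockMap p N' v) = v := by
  funext i
  by_cases hi : p i
  · rw [blockMap_apply_sub N _ ⟨i, hi⟩]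
    simp only [blockMap_apply_sub]
    rw [Matrix.mulVec_mulVec, h, Matrix.one_mulVec]
  · rw [blockMap_apply_of_not _ _ hi, blockMap_apply_of_not _ _ hi]

lemma blockMap_of_supported_not (N : Matrix {i // p i} {i // p i} (ZMod 2)) {v : Bits m}
    (hv : ∀ i, p i → v i = 0) : blockMap p N v = v := by
  funext i
  by_cases hi : p i
  · have : (fun k : {i // p i} => v k.1) = 0 := funext fun k => hv _ k.2
    rw [blockMap_apply_sub N v ⟨i, hi⟩, this, Matrix.mulVec_zero]
    exact (hv i hi).symm
  · exact blockMap_apply_of_not _ _ hi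

lemma dotProduct_eq_sum_subtype {u v : Bits m} (hv : ∀ i, ¬p i → v i = 0) :
    u ⬝ᵥ v = (fun k : {i // p i} => u k.1) ⬝ᵥ fun k => v k.1 := by
  rw [dotProduct, dotProduct, ← Finset.sum_subtype (Finset.univ.filter p) (by simp)
    (fun i => u i * v i), Finset.sum_filter]
  refine Finset.sum_congr rfl fun i _ => ?_
  split_ifs with h
  · rfl
  · rw [hv i h, mul_zero]

/-- On vectors supported on the block, the transposed matrix gives the adjoint. -/
lemma dotProduct_blockMap (N : Matrix {i // p i} {i // p i} (ZMod 2)) {u v : Bits m}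
    (hv : ∀ i, ¬p i → v i = 0) :
    u ⬝ᵥ blockMap p N v = blockMap p Nᵀ u ⬝ᵥ v := by
  have hv' : ∀ i, ¬p i → blockMap p N v i = 0 := fun i hi => by
    rw [blockMap_apply_of_not _ _ hi, hv i hi]
  rw [dotProduct_eq_sum_subtype hv, dotProduct_eq_sum_subtype hv']
  simp only [blockMap_apply_sub]
  rw [Matrix.dotProduct_mulVec, ← Matrix.mulVec_transpose]

/-- `blockMap` of an invertible matrix. -/
def blockEquiv {N N' : Matrix {i // p i} {i // p i} (ZMod 2)} (h : N * N' = 1) (h' : N' * N = 1) :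
    Bits m ≃ₗ[ZMod 2] Bits m :=
  LinearEquiv.ofLinearMap (blockMap p N) (blockMap p N')
    (LinearMap.ext fun v => blockMap_blockMap h v) (LinearMap.ext fun v => blockMap_blockMap h' v)

/-- Gaussian elimination by rows and columns. -/
lemma exists_normal_form {I J K : Type*} [Field K] [Fintype I] [Fintype J] [DecidableEq I]
    [DecidableEq J] (e : I ≃ J) (δ : Matrix J I K) :
    ∃ (Q Q' : Matrix J J K) (B B' : Matrix I I K) (D : I → K),
      Q * Q' = 1 ∧ Q' * Q = 1 ∧ B * B' = 1 ∧ B' * B = 1 ∧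
        ∀ j i, (δ * B) j i = Q' j (e i) * D i := by
  obtain ⟨L, L', D, hD⟩ :=
    Matrix.Pivot.exists_list_transvec_mul_mul_list_transvec_eq_diagonal (δ.submatrix e id)
  set A := (L.map Matrix.TransvectionStruct.toMatrix).prod with hA
  set B := (L'.map Matrix.TransvectionStruct.toMatrix).prod with hB
  have hdA : IsUnit A.det := by
    rw [hA, Matrix.TransvectionStruct.det_toMatrix_prod]; exact isUnit_one
  have hdB : IsUnit B.det := by
    rw [hB, Matrix.TransvectionStruct.det_toMatrix_prod]; exact isUnit_one
  refine ⟨A.submatrix e.symm e.symm, A⁻¹.submatrix e.symm e.symm, B, B⁻¹, D, ?_, ?_,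
    Matrix.mul_nonsing_inv _ hdB, Matrix.nonsing_inv_mul _ hdB, fun j i => ?_⟩
  · rw [Matrix.submatrix_mul_equiv, Matrix.mul_nonsing_inv _ hdA, Matrix.submatrix_one_equiv]
  · rw [Matrix.submatrix_mul_equiv, Matrix.nonsing_inv_mul _ hdA, Matrix.submatrix_one_equiv]
  · have h : δ.submatrix e id * B = A⁻¹ * Matrix.diagonal D := by
      rw [← hD, Matrix.mul_assoc A, Matrix.nonsing_inv_mul_cancel_left _ _ hdA]
    have h2 := congrFun (congrFun h (e.symm j)) i
    rw [Matrix.mul_diagonal] at h2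
    rw [Matrix.submatrix_apply, Equiv.symm_apply_apply, ← h2]
    simp [Matrix.mul_apply]

end BlockMap

noncomputable section Reduce

variable {m : ℕ} (W : Grass m)

lemma bobPart_add (v w : Bits (m + m)) : bobPart (v + w) = bobPart v + bobPart w := rfl

lemma charliePart_add (v w : Bits (m + m)) :
    charliePart (v + w) = charliePart v + charliePart w := rfl

lemma append_add (b b' c c' : Bits m) :
    Fin.append (b + b') (c + c') = Fin.append b c + Fin.append b' c' := by
  rw [← append_parts (Fin.append b c + Fin.append b' c'), bobPart_add, charliePart_add]
  simp

lemma append_smul (a : ZMod 2) (b c : Bits m) :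
    Fin.append (a • b) (a • c) = a • Fin.append b c := by
  rw [← append_parts (a • Fin.append b c)]
  change _ = Fin.append (a • bobPart (Fin.append b c)) (a • charliePart (Fin.append b c))
  simp

lemma dotProduct_split (v w : Bits (m + m)) :
    v ⬝ᵥ w = bobPart v ⬝ᵥ bobPart w + charliePart v ⬝ᵥ charliePart w := by
  simp only [dotProduct, Fin.sum_univ_add]
  rfl

/-- `pivotLift` on vectors that vanish on Charlie's half. -/
def bobLift : Bits m →ₗ[ZMod 2] Bits (m + m) where
  toFun b := pivotLift W.1 (Fin.append b 0)
  map_add' b b' := by rw [← map_add, ← append_add, add_zero]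
  map_smul' a b := by
    rw [RingHom.id_apply, ← map_smul, ← append_smul, smul_zero]

/-- `pivotLift` on vectors that vanish on Bob's half. -/
def charlieLift : Bits m →ₗ[ZMod 2] Bits (m + m) where
  toFun c := pivotLift W.1 (Fin.append 0 c)
  map_add' c c' := by rw [← map_add, ← append_add, add_zero]
  map_smul' a c := by
    rw [RingHom.id_apply, ← map_smul, ← append_smul, smul_zero]

variable {W}

lemma bobLift_add_charlieLift (b c : Bits m) :
    bobLift W b + charlieLift W c = pivotLift W.1 (Fin.append b c) := by
  change pivotLift W.1 _ + pivotLift W.1 _ = _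
  rw [← map_add, ← append_add, add_zero, zero_add]

lemma bobLift_castAdd {b : Bits m} {i : Fin m} (hi : Fin.castAdd m i ∈ pivots W.1) :
    bobLift W b (Fin.castAdd m i) = b i :=
  (pivotLift_apply _ hi).trans (Fin.append_left _ _ _)

lemma bobLift_natAdd {b : Bits m} {j : Fin m} (hj : Fin.natAdd m j ∈ pivots W.1) :
    bobLift W b (Fin.natAdd m j) = 0 :=
  (pivotLift_apply _ hj).trans (Fin.append_right _ _ _)

lemma charlieLift_natAdd {c : Bits m} {j : Fin m} (hj : Fin.natAdd m j ∈ pivots W.1) :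
    charlieLift W c (Fin.natAdd m j) = c j :=
  (pivotLift_apply _ hj).trans (Fin.append_right _ _ _)

/-- A row of the generator matrix whose pivot belongs to Charlie vanishes on Bob's half. -/
lemma charlieLift_castAdd (c : Bits m) (i : Fin m) : charlieLift W c (Fin.castAdd m i) = 0 := by
  have h : bobPart (charlieLift W c) = 0 := by
    refine eq_zero_of_pivots (W := bobSpace W) ⟨_, pivotLift_mem _, rfl⟩ fun i hi => ?_
    exact (pivotLift_apply _ (castAdd_mem_pivots.2 hi)).trans (Fin.append_left _ _ _)
  exact congrFun h i

lemma bobLift_congr {b b' : Bits m} (h : ∀ i, Fin.castAdd m i ∈ pivots W.1 → b i = b' i) :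
    bobLift W b = bobLift W b' := by
  refine pivotLift_eq (pivotLift_mem _) fun i => ?_
  refine Fin.addCases (fun i hi => ?_) (fun j hj => ?_) i
  · rw [bobLift_castAdd hi, Fin.append_left, h i hi]
  · rw [bobLift_natAdd hj, Fin.append_right, Pi.zero_apply]

lemma charlieLift_congr {c c' : Bits m} (h : ∀ j, Fin.natAdd m j ∈ pivots W.1 → c j = c' j) :
    charlieLift W c = charlieLift W c' := by
  refine pivotLift_eq (pivotLift_mem _) fun i => ?_
  refine Fin.addCases (fun i hi => ?_) (fun j hj => ?_) i
  · rw [charlieLift_castAdd, Fin.append_left, Pi.zero_apply]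
  · rw [charlieLift_natAdd hj, Fin.append_right, h j hj]

open Classical in
/-- The shear of Bob's half that adds to the `i`-th basis vector, for each pivot `i`, the remaining
entries of Bob's part of the row of the generator matrix with this pivot. -/
def bobShear (W : Grass m) : Bits m ≃ₗ[ZMod 2] Bits m :=
  LinearEquiv.ofInvolutive
    { toFun := fun b i => b i + if Fin.castAdd m i ∈ pivots W.1 then 0
        else bobLift W b (Fin.castAdd m i)
      map_add' := fun b b' => by
        funext i
        simp only [map_add, Pi.add_apply]
        split_ifs <;> ring
      map_smul' := fun a b => by
        funext i
        simp only [map_smul, Pi.smul_apply, RingHom.id_apply, smul_eq_mul]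
        split_ifs <;> ring } <| fun b => by
    have h : bobLift W (fun i => b i + if Fin.castAdd m i ∈ pivots W.1 then 0
        else bobLift W b (Fin.castAdd m i)) = bobLift W b :=
      bobLift_congr fun i hi => by rw [if_pos hi, add_zero]
    funext i
    simp only [LinearMap.coe_mk, AddHom.coe_mk, h]
    rw [add_assoc, CharTwo.add_self_eq_zero, add_zero]

open Classical in
/-- The analogous shear of Charlie's half. -/
def charlieShear (W : Grass m) : Bits m ≃ₗ[ZMod 2] Bits m :=
  LinearEquiv.ofInvolutive
    { toFun := fun c j => c j + if Fin.natAdd m j ∈ pivots W.1 then 0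
        else charlieLift W c (Fin.natAdd m j)
      map_add' := fun c c' => by
        funext i
        simp only [map_add, Pi.add_apply]
        split_ifs <;> ring
      map_smul' := fun a c => by
        funext i
        simp only [map_smul, Pi.smul_apply, RingHom.id_apply, smul_eq_mul]
        split_ifs <;> ring } <| fun c => by
    have h : charlieLift W (fun j => c j + if Fin.natAdd m j ∈ pivots W.1 then 0
        else charlieLift W c (Fin.natAdd m j)) = charlieLift W c :=
      charlieLift_congr fun i hi => by rw [if_pos hi, add_zero]
    funext i
    simp only [LinearMap.coe_mk, AddHom.coe_mk, h]
    rw [add_assoc, CharTwo.add_self_eq_zero, add_zero]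

open Classical in
lemma bobShear_apply (b : Bits m) (i : Fin m) : bobShear W b i =
    b i + if Fin.castAdd m i ∈ pivots W.1 then 0 else bobLift W b (Fin.castAdd m i) := rfl

open Classical in
lemma charlieShear_apply (c : Bits m) (j : Fin m) : charlieShear W c j =
    c j + if Fin.natAdd m j ∈ pivots W.1 then 0 else charlieLift W c (Fin.natAdd m j) := rfl

lemma bobShear_of_supported_not {b : Bits m} (hb : ∀ i, Fin.castAdd m i ∈ pivots W.1 → b i = 0) :
    bobShear W b = b := by
  funext i
  rw [bobShear_apply, bobLift_congr (b' := 0) hb, map_zero]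
  simp

lemma charlieShear_of_supported_not {c : Bits m}
    (hc : ∀ j, Fin.natAdd m j ∈ pivots W.1 → c j = 0) : charlieShear W c = c := by
  funext i
  rw [charlieShear_apply, charlieLift_congr (c' := 0) hc, map_zero]
  simp

open Classical in
/-- If a change of basis `Γ` maps the vectors supported on the pivots to `W`, then it maps a state
obtained by Hadamard gates at the pivots to a coset state of `W`. -/
lemma cosetState_apply_of_basis_change (Γ : Bits (m + m) →ₗ[ZMod 2] Bits (m + m))
    (hinj : Function.Injective Γ) (hW : ∀ s, (∀ i ∉ pivots W.1, s i = 0) → Γ s ∈ W.1)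
    (hR : ∀ r, (∀ i ∈ pivots W.1, r i = 0) → ∀ i ∈ pivots W.1, Γ r i = 0)
    {x z y : Bits (m + m)}
    (hx : Γ (fun i => if i ∈ pivots W.1 then 0 else y i) = x)
    (hz : ∀ s, (∀ i ∉ pivots W.1, s i = 0) → z ⬝ᵥ Γ s = y ⬝ᵥ s) (v : Bits (m + m)) :
    cosetState W x z (Γ v) = hadamardOn (Finset.univ.filter (· ∈ pivots W.1)) v y := by
  have hmem : ∀ u, Γ u ∈ W.1 ↔ ∀ i ∉ pivots W.1, u i = 0 := by
    intro u
    refine ⟨fun hu i hi => ?_, hW u⟩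
    have h1 : (fun i => if i ∈ pivots W.1 then u i else 0) +
        (fun i => if i ∈ pivots W.1 then 0 else u i) = u := by
      funext i
      by_cases h : i ∈ pivots W.1 <;> simp [h]
    have h2 : Γ (fun i => if i ∈ pivots W.1 then 0 else u i) = 0 := by
      refine eq_zero_of_pivots ?_ (hR _ fun i hi => if_pos hi)
      have h3 := W.1.sub_mem hu (hW (fun i => if i ∈ pivots W.1 then u i else 0)
        fun i hi => if_neg hi)
      rwa [← map_sub, ← eq_sub_of_add_eq' h1] at h3
    have h4 := congrFun (hinj (h2.trans (map_zero Γ).symm)) i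
    rwa [if_neg hi] at h4
  have hsub : ∀ i, (v - fun i => if i ∈ pivots W.1 then 0 else y i) i =
      if i ∈ pivots W.1 then v i else v i - y i := by
    intro i
    rw [Pi.sub_apply]
    split_ifs <;> simp
  rw [cosetState_apply, ← hx, ← map_sub, hmem, hadamardOn, tensorAll, Matrix.of_apply]
  simp only [Finset.mem_filter, Finset.mem_univ, true_and]
  by_cases hv : ∀ i ∉ pivots W.1, v i = y i
  · have hsupp : ∀ i ∉ pivots W.1, (v - fun i => if i ∈ pivots W.1 then 0 else y i) i = 0 := by
      intro i hi
      rw [hsub, if_neg hi, hv i hi, sub_self]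
    rw [if_pos hsupp, hz _ hsupp]
    have h1 : ∀ i, (if i ∈ pivots W.1 then hadamardMatrix else 1) (v i) (y i) =
        (if i ∈ pivots W.1 then ((1 / Real.sqrt 2 : ℝ) : ℂ) else 1) *
          sgn (y i * (v - fun i => if i ∈ pivots W.1 then 0 else y i) i) := by
      intro i
      rw [hsub]
      split_ifs with hi
      · rw [hadamardMatrix, Matrix.of_apply, mul_comm (v i)]
      · rw [hv i hi, Matrix.one_apply_eq, sub_self, mul_zero, sgn_zero, one_mul]
    rw [Finset.prod_congr rfl fun i _ => h1 i, Finset.prod_mul_distrib, ← sgn_sum,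
      ← Finset.prod_filter, Finset.prod_const, card_pivots_grass]
    have h2 : Real.sqrt (2 ^ m) = Real.sqrt 2 ^ m := by
      rw [Real.sqrt_eq_iff_mul_self_eq (by positivity) (by positivity), ← mul_pow,
        Real.mul_self_sqrt zero_le_two]
    rw [h2, ← Complex.ofReal_pow, one_div_pow]
    rfl
  · push Not at hv
    obtain ⟨i, hi, hne⟩ := hv
    rw [if_neg fun h => hne ?_, mul_zero, Finset.prod_eq_zero (Finset.mem_univ i)]
    · rw [if_neg hi, Matrix.one_apply_ne hne]
    · have := h i hi
      rw [hsub, if_neg hi] at this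
      exact sub_eq_zero.mp this

lemma localOp_hadamardOn {A₁ A₂ : Finset (Fin m)} {A : Finset (Fin (m + m))}
    (h₁ : ∀ i, Fin.castAdd m i ∈ A ↔ i ∈ A₁) (h₂ : ∀ j, Fin.natAdd m j ∈ A ↔ j ∈ A₂) :
    localOp (hadamardOn A₁) (hadamardOn A₂) = hadamardOn A := by
  rw [hadamardOn, hadamardOn, localOp_tensorAll, hadamardOn]
  congr 1
  funext i
  refine Fin.addCases (fun i => ?_) (fun j => ?_) i
  · simp only [Fin.append_left, h₁]
  · simp only [Fin.append_right, h₂]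

end Reduce

/-! ### Existence of the reduction -/

noncomputable section Existence

variable {m : ℕ}

lemma cnotsMap_add {n ℓ : ℕ} (c d : Fin ℓ → Fin n) (v w : Bits n) :
    cnotsMap c d (v + w) = cnotsMap c d v + cnotsMap c d w := by
  funext i
  simp only [cnotsMap, Pi.add_apply]
  rw [add_add_add_comm, ← Finset.sum_add_distrib]
  congr 1
  refine Finset.sum_congr rfl fun t _ => ?_
  split_ifs <;> simp

lemma bobLift_apply_eq_dotProduct {W : Grass m} (b : Bits m) (k : Fin (m + m)) :
    bobLift W b k = (fun i => bobLift W (Pi.single i 1) k) ⬝ᵥ b := by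
  nth_rw 1 [pi_eq_sum_univ' b]
  simp only [map_sum, map_smul, Finset.sum_apply, Pi.smul_apply, smul_eq_mul, dotProduct]
  exact Finset.sum_congr rfl fun i _ => mul_comm _ _

@[simp] lemma bobPart_pairMap (g₁ g₂ : Bits m ≃+ Bits m) (v : Bits (m + m)) :
    bobPart (pairMap g₁ g₂ v) = g₁ (bobPart v) := bobPart_append _ _

@[simp] lemma charliePart_pairMap (g₁ g₂ : Bits m ≃+ Bits m) (v : Bits (m + m)) :
    charliePart (pairMap g₁ g₂ v) = g₂ (charliePart v) := charliePart_append _ _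

lemma pairMap_add (g₁ g₂ : Bits m ≃+ Bits m) (v w : Bits (m + m)) :
    pairMap g₁ g₂ (v + w) = pairMap g₁ g₂ v + pairMap g₁ g₂ w := by
  rw [pairMap, pairMap, pairMap, ← append_add, bobPart_add, charliePart_add, map_add, map_add]

lemma pairMap_pairMap_symm (g₁ g₂ : Bits m ≃+ Bits m) (v : Bits (m + m)) :
    pairMap g₁ g₂ (pairMap g₁.symm g₂.symm v) = v := by
  rw [pairMap, bobPart_pairMap, charliePart_pairMap, AddEquiv.apply_symm_apply,
    AddEquiv.apply_symm_apply, append_parts]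

lemma pairMap_symm_pairMap (g₁ g₂ : Bits m ≃+ Bits m) (v : Bits (m + m)) :
    pairMap g₁.symm g₂.symm (pairMap g₁ g₂ v) = v := by
  rw [pairMap, bobPart_pairMap, charliePart_pairMap, AddEquiv.symm_apply_apply,
    AddEquiv.symm_apply_apply, append_parts]

open Classical in
/-- Changes of basis `G₁`, `G₂` of the two halves that turn the vectors `e_{i_t} + e_{j_t}` and
`e_i`, for the other pivots `i`, into a basis of `W`. The generator matrix of `W` in reduced row echelon
form is brought to this shape by a shear on each side, which clears the entries in the pivot rows on
the side of the pivot, and by bringing the remaining block, with rows the pivots of Bob and columns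
the non-pivots of Charlie, to diagonal form. -/
lemma exists_bell_basis (W : Grass m) :
    ∃ (G₁ G₂ f₁ f₂ : Bits m ≃ₗ[ZMod 2] Bits m) (ℓ : ℕ) (i j : Fin ℓ → Fin m),
      Function.Injective i ∧ Function.Injective j ∧
      (∀ t, Fin.castAdd m (i t) ∈ pivots W.1) ∧ (∀ t, Fin.natAdd m (j t) ∉ pivots W.1) ∧
      (∀ b, (∀ k, Fin.castAdd m k ∈ pivots W.1 → b k = 0) → f₁ b = b) ∧
      (∀ c, (∀ k, Fin.natAdd m k ∉ pivots W.1 → c k = 0) → f₂ c = c) ∧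
      (∀ b k, Fin.castAdd m k ∉ pivots W.1 → f₁ b k = b k) ∧
      (∀ c k, Fin.natAdd m k ∈ pivots W.1 → f₂ c k = c k) ∧
      ∀ x ∈ canonRep m W, ∀ z ∈ canonRepPerp m W, ∀ v,
        cosetState W x z (pairMap G₁.toAddEquiv G₂.toAddEquiv
          (cnotsMap (fun t => Fin.castAdd m (i t)) (fun t => Fin.natAdd m (j t)) v)) =
          hadamardOn (Finset.univ.filter (· ∈ pivots W.1)) v
            (pairMap f₁.toAddEquiv f₂.toAddEquiv (x + z)) := by
  let p : Fin m → Prop := fun k => Fin.castAdd m k ∈ pivots W.1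
  let q : Fin m → Prop := fun k => Fin.natAdd m k ∉ pivots W.1
  have hcard : Fintype.card {k // p k} = Fintype.card {k // q k} := by
    rw [Fintype.card_subtype, Fintype.card_subtype, card_bob_pivots]
    convert (card_charlie_not_pivots W).symm
  obtain e : {k // p k} ≃ {k // q k} := Fintype.equivOfCardEq hcard
  let δ : Matrix {k // q k} {k // p k} (ZMod 2) :=
    Matrix.of fun j i => bobLift W (Pi.single i.1 1) (Fin.natAdd m j.1)
  obtain ⟨Q, Q', B, B', D, hQ, hQ', hB, hB', hD⟩ := exists_normal_form e δ
  let ε := (Fintype.equivFin {a : {k // p k} // D a ≠ 0}).symm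
  let i : Fin (Fintype.card {a : {k // p k} // D a ≠ 0}) → Fin m := fun t => (ε t).1.1
  let j : Fin (Fintype.card {a : {k // p k} // D a ≠ 0}) → Fin m := fun t => (e (ε t).1).1
  have hi : Function.Injective i :=
    Subtype.val_injective.comp (Subtype.val_injective.comp ε.injective)
  have hj : Function.Injective j :=
    Subtype.val_injective.comp (e.injective.comp (Subtype.val_injective.comp ε.injective))
  let κ := cnotsMap (fun t => Fin.castAdd m (i t)) (fun t => Fin.natAdd m (j t))
  have hne : ∀ a b, Fin.castAdd m a ≠ Fin.natAdd m b := fun a b h => by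
    have := congrArg Fin.val h
    simp only [Fin.val_castAdd, Fin.val_natAdd] at this
    omega
  have hκκ : ∀ v, κ (κ v) = v := cnotsMap_cnotsMap fun _ _ => hne _ _
  have hκB : ∀ v, bobPart (κ v) = bobPart v := by
    intro v
    funext k
    change v _ + _ = v _
    rw [Finset.sum_eq_zero fun t _ => if_neg (hne _ _).symm, add_zero]
  have hκI : ∀ v k, Fin.natAdd m k ∈ pivots W.1 → charliePart (κ v) k = charliePart v k := by
    intro v k hk
    change v _ + _ = v _
    rw [Finset.sum_eq_zero, add_zero]
    intro t _
    refine if_neg fun h => (e (ε t).1).2 ?_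
    rw [show (e (ε t).1).1 = k from Fin.natAdd_injective m m h]
    exact hk
  have hκC : ∀ v (a : {k // p k}), charliePart (κ v) (e a).1 =
      charliePart v (e a).1 + D a * bobPart v a.1 := by
    intro v a
    change v _ + _ = v _ + _
    congr 1
    by_cases hDa : D a = 0
    · rw [hDa, zero_mul]
      refine Finset.sum_eq_zero fun t _ => if_neg fun h => ?_
      have h1 : e (ε t).1 = e a := Subtype.ext (Fin.natAdd_injective m m h)
      have h2 := (ε t).2
      rw [e.injective h1] at h2
      exact h2 hDa
    · rw [zmod_two_eq_one hDa, one_mul, Finset.sum_eq_single (ε.symm ⟨a, hDa⟩)]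
      · simp only [i, j, Equiv.apply_symm_apply, if_true]
        rfl
      · intro t _ ht
        refine if_neg fun h => ht ?_
        have h1 : e (ε t).1 = e a := Subtype.ext (Fin.natAdd_injective m m h)
        rw [Equiv.eq_symm_apply]
        exact Subtype.ext (e.injective h1)
      · simp
  let G₁ : Bits m ≃ₗ[ZMod 2] Bits m := (blockEquiv (p := p) hB hB').trans (bobShear W)
  let G₂ : Bits m ≃ₗ[ZMod 2] Bits m := (blockEquiv (p := q) hQ' hQ).trans (charlieShear W)
  have hBT : Bᵀ * B'ᵀ = 1 := by rw [← Matrix.transpose_mul, hB', Matrix.transpose_one]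
  have hBT' : B'ᵀ * Bᵀ = 1 := by rw [← Matrix.transpose_mul, hB, Matrix.transpose_one]
  let f₁ : Bits m ≃ₗ[ZMod 2] Bits m := blockEquiv (p := p) hBT hBT'
  let f₂ : Bits m ≃ₗ[ZMod 2] Bits m := blockEquiv (p := q) hQ hQ'
  refine ⟨G₁, G₂, f₁, f₂, _, i, j, hi, hj, fun t => (ε t).1.2, fun t => (e (ε t).1).2,
    fun b hb => blockMap_of_supported_not _ hb, fun c hc => blockMap_of_supported_not _ hc,
    fun b k hk => blockMap_apply_of_not _ _ hk,
    fun c k hk => blockMap_apply_of_not _ _ (not_not.mpr hk), fun x hx z hz => ?_⟩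
  rw [mem_canonRep] at hx
  rw [mem_canonRepPerp] at hz
  have hxB : ∀ l, p l → bobPart x l = 0 := fun l hl => hx _ hl
  have hxC : ∀ l, Fin.natAdd m l ∈ pivots W.1 → charliePart x l = 0 := fun l hl => hx _ hl
  have hzC : ∀ l, q l → charliePart z l = 0 := fun l hl => hz _ hl
  let Γ : Bits (m + m) →+ Bits (m + m) :=
    AddMonoidHom.mk' (fun v => pairMap G₁.toAddEquiv G₂.toAddEquiv (κ v)) fun v w => by
      rw [← pairMap_add, ← cnotsMap_add]
  have hΓB : ∀ v k, Γ v (Fin.castAdd m k) = bobShear W (blockMap p B (bobPart v)) k := by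
    intro v k
    change bobPart (pairMap G₁.toAddEquiv G₂.toAddEquiv (κ v)) k = _
    rw [bobPart_pairMap, hκB]
    rfl
  have hΓC : ∀ v k, Γ v (Fin.natAdd m k) =
      charlieShear W (blockMap q Q' (charliePart (κ v))) k := by
    intro v k
    change charliePart (pairMap G₁.toAddEquiv G₂.toAddEquiv (κ v)) k = _
    rw [charliePart_pairMap]
    rfl
  have hΓ : ∀ s, (∀ k ∉ pivots W.1, s k = 0) → Γ s =
      pivotLift W.1 (Fin.append (blockMap p B (bobPart s)) (charliePart s)) := by
    intro s hs
    rw [← bobLift_add_charlieLift]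
    funext k
    refine Fin.addCases (fun k => ?_) (fun k => ?_) k
    · rw [hΓB, bobShear_apply, Pi.add_apply, charlieLift_castAdd, add_zero]
      split_ifs with hk
      · rw [bobLift_castAdd hk, add_zero]
      · rw [blockMap_apply_of_not (p := p) _ _ hk, show bobPart s k = 0 from hs _ hk, zero_add]
    · rw [hΓC, charlieShear_apply, Pi.add_apply]
      split_ifs with hk
      · rw [bobLift_natAdd hk, charlieLift_natAdd hk, zero_add, add_zero,
          blockMap_apply_of_not _ _ (not_not.mpr hk), hκI _ _ hk]
      · congr 1
        · rw [blockMap_apply_sub Q' _ ⟨k, hk⟩, bobLift_apply_eq_dotProduct,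
            dotProduct_eq_sum_subtype (p := p) fun l hl => by
              rw [blockMap_apply_of_not _ _ hl]; exact hs _ hl]
          simp only [blockMap_apply_sub]
          change _ = (δ *ᵥ (B *ᵥ fun a => bobPart s a.1)) ⟨k, hk⟩
          rw [Matrix.mulVec_mulVec, Matrix.mulVec, Matrix.mulVec, dotProduct, dotProduct,
            ← e.sum_comp]
          refine Finset.sum_congr rfl fun a _ => ?_
          rw [hκC, hD, show charliePart s (e a).1 = 0 from hs _ (e a).2, zero_add, mul_assoc]
        · rw [charlieLift_congr]
          intro l hl
          rw [blockMap_apply_of_not _ _ (not_not.mpr hl), hκI _ _ hl]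
  refine cosetState_apply_of_basis_change (Γ.toZModLinearMap 2) ?_ (fun s hs => ?_)
    (fun r hr k hk => ?_) ?_ fun s hs => ?_
  · intro v w hvw
    have h1 := congrArg (pairMap G₁.toAddEquiv.symm G₂.toAddEquiv.symm) hvw
    change pairMap _ _ (pairMap _ _ (κ v)) = pairMap _ _ (pairMap _ _ (κ w)) at h1
    rw [pairMap_symm_pairMap, pairMap_symm_pairMap] at h1
    have h2 := congrArg κ h1
    rwa [hκκ, hκκ] at h2
  · exact (hΓ s hs).symm ▸ pivotLift_mem _
  · change Γ r k = 0
    revert hk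
    refine Fin.addCases (fun k hk => ?_) (fun k hk => ?_) k
    · have hrB : ∀ l, p l → bobPart r l = 0 := fun l hl => hr _ hl
      rw [hΓB, blockMap_of_supported_not _ hrB, bobShear_of_supported_not hrB]
      exact hr _ hk
    · rw [hΓC, charlieShear_apply, if_pos hk, add_zero,
        blockMap_apply_of_not _ _ (not_not.mpr hk), hκI _ _ hk]
      exact hr _ hk
  · set r : Bits (m + m) := fun k => if k ∈ pivots W.1 then 0 else
      pairMap f₁.toAddEquiv f₂.toAddEquiv (x + z) k with hr
    have hrB : bobPart r = bobPart x := by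
      funext k
      by_cases hk : p k
      · rw [hxB k hk]; exact if_pos hk
      · refine (if_neg hk).trans ?_
        change bobPart (pairMap f₁.toAddEquiv f₂.toAddEquiv (x + z)) k = _
        rw [bobPart_pairMap]
        change blockMap p Bᵀ _ k = _
        rw [blockMap_apply_of_not _ _ hk]
        change x _ + z _ = x _
        rw [hz _ hk, add_zero]
    have hrC : charliePart r = blockMap q Q (charliePart x) := by
      funext k
      by_cases hk : q k
      · refine (if_neg hk).trans ?_
        change charliePart (pairMap f₁.toAddEquiv f₂.toAddEquiv (x + z)) k = _
        rw [charliePart_pairMap]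
        change blockMap q Q (charliePart x + charliePart z) k = _
        rw [map_add, blockMap_of_supported_not _ hzC, Pi.add_apply, hzC k hk, add_zero]
      · rw [blockMap_apply_of_not _ _ hk, hxC k (not_not.mp hk)]
        exact if_pos (not_not.mp hk)
    have hκr : charliePart (κ r) = charliePart r := by
      funext k
      by_cases hk : q k
      · have h := hκC r (e.symm ⟨k, hk⟩)
        rwa [hrB, hxB _ (e.symm ⟨k, hk⟩).2, mul_zero, add_zero, Equiv.apply_symm_apply] at h
      · exact hκI _ _ (not_not.mp hk)
    change Γ r = x
    funext k
    refine Fin.addCases (fun k => ?_) (fun k => ?_) k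
    · rw [hΓB, hrB, blockMap_of_supported_not _ hxB, bobShear_of_supported_not hxB]
      rfl
    · rw [hΓC, hκr, hrC, blockMap_blockMap hQ', charlieShear_of_supported_not hxC]
      rfl
  · change z ⬝ᵥ Γ s = _
    have hsB : ∀ l, ¬p l → bobPart s l = 0 := fun l hl => hs _ hl
    rw [hΓ s hs, dotProduct_split, dotProduct_split, bobPart_pairMap, charliePart_pairMap]
    congr 1
    · change _ = blockMap p Bᵀ (bobPart x + bobPart z) ⬝ᵥ bobPart s
      rw [map_add, blockMap_of_supported_not _ hxB, add_dotProduct,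
        ← dotProduct_blockMap _ hsB]
      have h0 : bobPart x ⬝ᵥ bobPart s = 0 := Finset.sum_eq_zero fun l _ => by
        by_cases hl : p l
        · rw [hxB l hl, zero_mul]
        · rw [hsB l hl, mul_zero]
      rw [h0, zero_add]
      refine Finset.sum_congr rfl fun l _ => ?_
      by_cases hl : p l
      · congr 1
        exact (pivotLift_apply _ hl).trans (Fin.append_left _ _ _)
      · rw [show bobPart z l = 0 from hz _ hl, zero_mul, zero_mul]
    · change _ = blockMap q Q (charliePart x + charliePart z) ⬝ᵥ charliePart s
      rw [map_add, blockMap_of_supported_not _ hzC, add_dotProduct]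
      have h0 : blockMap q Q (charliePart x) ⬝ᵥ charliePart s = 0 :=
        Finset.sum_eq_zero fun l _ => by
          by_cases hl : q l
          · rw [show charliePart s l = 0 from hs _ hl, mul_zero]
          · rw [blockMap_apply_of_not _ _ hl,
              hxC l (not_not.mp hl), zero_mul]
      rw [h0, zero_add]
      refine Finset.sum_congr rfl fun l _ => ?_
      by_cases hl : q l
      · rw [hzC l hl, zero_mul, zero_mul]
      · congr 1
        exact (pivotLift_apply _ (not_not.mp hl)).trans (Fin.append_right _ _ _)

/-- The circuits undo the changes of basis of `exists_bell_basis` by CNOT gates, and then apply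
Hadamard gates at the pivots that do not belong to a Bell pair. -/
lemma nonempty_reduction (W : Grass m) : Nonempty (Reduction W) := by
  classical
  obtain ⟨G₁, G₂, f₁, f₂, ℓ, i, j, hi, hj, hiI, hjI, hf₁, hf₂, hf₁', hf₂', hstate⟩ :=
    exists_bell_basis W
  obtain ⟨L₁, hL₁⟩ := exists_circuitOp_eq_permOp G₁.symm
  obtain ⟨L₂, hL₂⟩ := exists_circuitOp_eq_permOp G₂.symm
  let A : Finset (Fin (m + m)) := Finset.univ.filter fun k =>
    k ∈ pivots W.1 ∧ ∀ t, Fin.castAdd m (i t) ≠ k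
  obtain ⟨H₁, hH₁⟩ := exists_circuitOp_eq_hadamardOn
    (Finset.univ.filter fun k => Fin.castAdd m k ∈ A)
  obtain ⟨H₂, hH₂⟩ := exists_circuitOp_eq_hadamardOn
    (Finset.univ.filter fun k => Fin.natAdd m k ∈ A)
  have hne : ∀ s t, Fin.castAdd m (i s) ≠ Fin.natAdd m (j t) := fun s t h => hjI t (h ▸ hiI s)
  refine ⟨{
    bobCircuit := H₁ ++ L₁
    charlieCircuit := H₂ ++ L₂
    ell := ℓ
    bobIdx := i
    charlieIdx := j
    bobIdx_injective := hi
    charlieIdx_injective := hj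
    bobIdx_mem := hiI
    charlieIdx_notMem := hjI
    f₁ := f₁.toAddEquiv
    f₂ := f₂.toAddEquiv
    f₁_fix := fun x hx => hf₁ _ fun k hk => mem_canonRep.1 hx _ hk
    f₂_fix := fun z hz => hf₂ _ fun k hk => mem_canonRepPerp.1 hz _ hk
    map_canonRep := ?_
    map_canonRepPerp := ?_
    reduces := ?_ }⟩
  · refine fun x hx => mem_canonRep.2 (Fin.addCases (fun k hk => ?_) fun k hk => ?_)
    · change bobPart (pairMap _ _ x) k = 0
      rw [bobPart_pairMap]
      refine (congrFun (hf₁ _ fun k hk => mem_canonRep.1 hx _ hk) k).trans ?_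
      exact mem_canonRep.1 hx _ hk
    · change charliePart (pairMap _ _ x) k = 0
      rw [charliePart_pairMap]
      exact (hf₂' _ k hk).trans (mem_canonRep.1 hx _ hk)
  · refine fun z hz => mem_canonRepPerp.2 (Fin.addCases (fun k hk => ?_) fun k hk => ?_)
    · change bobPart (pairMap _ _ z) k = 0
      rw [bobPart_pairMap]
      exact (hf₁' _ k hk).trans (mem_canonRepPerp.1 hz _ hk)
    · change charliePart (pairMap _ _ z) k = 0
      rw [charliePart_pairMap]
      refine (congrFun (hf₂ _ fun k hk => mem_canonRepPerp.1 hz _ hk) k).trans ?_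
      exact mem_canonRepPerp.1 hz _ hk
  · intro x hx z hz
    set κ := cnotsMap (fun t => Fin.castAdd m (i t)) (fun t => Fin.natAdd m (j t)) with hκ
    have hκκ : ∀ v, κ (κ v) = v := cnotsMap_cnotsMap hne
    set g := pairMap G₁.toAddEquiv G₂.toAddEquiv with hg
    set g' := pairMap G₁.toAddEquiv.symm G₂.toAddEquiv.symm with hg'
    have hgg' : ∀ v, g (g' v) = v := pairMap_pairMap_symm _ _
    have hg'g : ∀ v, g' (g v) = v := pairMap_symm_pairMap _ _
    have hψ : cosetState W x z = permOp (g ∘ κ) *ᵥ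
        (hadamardOn (Finset.univ.filter (· ∈ pivots W.1)) *ᵥ
          ket (pairMap f₁.toAddEquiv f₂.toAddEquiv (x + z))) := by
      funext v
      rw [permOp_mulVec_apply (g ∘ κ) (κ ∘ g')
        (fun v => by simp only [Function.comp, hg'g, hκκ])
        (fun v => by simp only [Function.comp, hκκ, hgg']), mulVec_ket]
      refine Eq.trans ?_ (hstate x hx z hz ((κ ∘ g') v))
      change _ = cosetState W x z (g (κ (κ (g' v))))
      rw [hκκ, hgg']
    have hI : Finset.univ.filter (· ∈ pivots W.1) =
        A ∪ Finset.univ.image fun t => Fin.castAdd m (i t) := by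
      ext k
      simp only [A, Finset.mem_filter, Finset.mem_univ, true_and, Finset.mem_union,
        Finset.mem_image]
      constructor
      · intro hk
        by_cases h : ∃ t, Fin.castAdd m (i t) = k
        · exact Or.inr h
        · push Not at h
          exact Or.inl ⟨hk, h⟩
      · rintro (h | ⟨t, rfl⟩)
        · exact h.1
        · exact hiI t
    have hdisj : Disjoint A (Finset.univ.image fun t => Fin.castAdd m (i t)) := by
      rw [Finset.disjoint_left]
      intro k hk hk'
      obtain ⟨t, -, rfl⟩ := Finset.mem_image.1 hk'
      exact (Finset.mem_filter.1 hk).2.2 t rfl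
    have hprod := prod_cnot_mul_hadamard (fun t => Fin.castAdd m (i t))
      (fun t => Fin.natAdd m (j t)) ((Fin.castAdd_injective m m).comp hi) hne
    have hcomm := (hprod.2 A (fun t h => (Finset.mem_filter.1 h).2.2 t rfl)
      fun t h => hjI t (Finset.mem_filter.1 h).2.1).eq
    have hperm : localOp (permOp G₁.symm) (permOp G₂.symm) = permOp g' := localOp_permOp _ _
    rw [hprod.1, circuitOp_append, circuitOp_append, localOp_mul, hH₁, hH₂, hL₁, hL₂,
      localOp_hadamardOn (A := A) (by simp) (fun k => by
        simp only [Finset.mem_filter, Finset.mem_univ, true_and]), hperm, hψ,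
      Matrix.mulVec_mulVec, Matrix.mulVec_mulVec, Matrix.mul_assoc (hadamardOn A) (permOp g'),
      permOp_mul, show g' ∘ g ∘ κ = κ from funext fun v => hg'g _, hcomm, hI,
      ← hadamardOn_mul_of_disjoint hdisj, Matrix.mul_assoc, ← Matrix.mul_assoc (hadamardOn A),
      hadamardOn_mul_self, Matrix.one_mul]

end Existence

/-! ### Optimality -/

noncomputable section Optimality

variable {m : ℕ}

lemma IsPOVM.comp_bijOn {X : Type} {n : ℕ} {S S' : Finset X} {E : X → Op n} (hE : IsPOVM S' E)
    {e : X → X} (he : Set.BijOn e S S') : IsPOVM S fun x => E (e x) := by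
  refine ⟨fun x hx => hE.1 _ (he.1 hx), ?_⟩
  rw [← hE.2]
  exact Finset.sum_bij (fun x _ => e x) (fun x hx => he.1 hx)
    (fun x hx y hy h => he.2.1 hx hy h)
    (fun y hy => (he.2.2 hy).imp fun x hx => ⟨hx.1, hx.2⟩) fun _ _ => rfl

/-- A strategy for one choice of representatives gives one for any other choice. -/
lemma exists_strategy_of_reps {S T S' T' : RepFamily m} (h : AreRepFamilies S T)
    (h' : AreRepFamilies S' T') {B C : Answers m} (hBC : IsStrategy S' T' B C) :
    ∃ B' C' : Answers m, IsStrategy S T B' C' ∧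
      ∀ W, winProbAt S T B' C' W = winProbAt S' T' B C W := by
  choose e he hbij using fun W => (h W).1.exists_bijOn (h' W).1
  choose e' he' hbij' using fun W => (h W).2.exists_bijOn (h' W).2
  refine ⟨fun W x => B W (e W x), fun W z => C W (e' W z), fun W =>
    ⟨(hBC W).1.comp_bijOn (hbij W), (hBC W).2.comp_bijOn (hbij' W)⟩, fun W => ?_⟩
  rw [winProbAt, winProbAt, (h W).1.card_eq (h' W).1, (h W).2.card_eq (h' W).2]
  congr 1
  have hreindex : ∀ {A A' : Finset (Bits (m + m))} {g : Bits (m + m) → Bits (m + m)}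
      (_ : Set.BijOn g A A') (F : Bits (m + m) → ℝ), ∑ x ∈ A, F (g x) = ∑ x ∈ A', F x :=
    fun hg F => Finset.sum_bij (fun x _ => _) (fun x hx => hg.1 hx)
      (fun x hx y hy hxy => hg.2.1 hx hy hxy)
      (fun y hy => (hg.2.2 hy).imp fun x hx => ⟨hx.1, hx.2⟩) fun _ _ => rfl
  rw [← hreindex (hbij W)]
  refine Finset.sum_congr rfl fun x _ => ?_
  rw [← hreindex (hbij' W)]
  refine Finset.sum_congr rfl fun z _ => ?_
  have := proj_cosetState_add W (e W x) (e' W z) (he W x) (he' W z)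
  rw [add_sub_cancel, add_sub_cancel] at this
  rw [winProbXZ, winProbXZ, this]

lemma winProb_le {S T : RepFamily m} (hST : AreRepFamilies S T) {B C : Answers m}
    (h : IsStrategy S T B C) : winProb S T B C ≤ optimalValue m := by
  rw [winProb, optimalValue_eq, ← sum_half_pow_bobDim]
  gcongr with W
  exact winProbAt_le hST h W

lemma winProb_eq_optimalValue {S T : RepFamily m} {B C : Answers m}
    (h : ∀ W, winProbAt S T B C W = (1 / 2) ^ bobDim W) : winProb S T B C = optimalValue m := by
  rw [winProb, optimalValue_eq, ← sum_half_pow_bobDim, Finset.sum_congr rfl fun W _ => h W]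

lemma isGreatest_optimalValue {S T : RepFamily m} (hST : AreRepFamilies S T) :
    IsGreatest {p : ℝ | ∃ B C : Answers m, IsStrategy S T B C ∧ winProb S T B C = p}
      (optimalValue m) := by
  constructor
  · let R : ∀ W : Grass m, Reduction W := fun W => (nonempty_reduction W).some
    let h : ∀ W, (R W).Matching := fun W => (nonempty_matching (R W)).some
    obtain ⟨B, C, hBC, hwin⟩ := exists_strategy_of_reps hST (areRepFamilies_canon m)
      (isStrategy_explicit R h)
    exact ⟨B, C, hBC, winProb_eq_optimalValue fun W => (hwin W).trans (winProbAt_explicit R h W)⟩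
  · rintro _ ⟨B, C, hBC, rfl⟩
    exact winProb_le hST hBC

end Optimality

end CosetGame

theorem theorem2 :
    -- the optimal winning probability is attained and equals `optimalValue m`,
    -- for any choice of coset representatives
    (∀ (m : ℕ) (S T : RepFamily m), AreRepFamilies S T →
      IsGreatest {p : ℝ | ∃ B C : Answers m, IsStrategy S T B C ∧ winProb S T B C = p}
        (optimalValue m)) ∧
    -- its rate of decay
    Asymptotics.IsTheta Filter.atTop optimalValue (fun m : ℕ => 1 / (2 : ℝ) ^ m) ∧
    -- the explicit strategy can be carried out, ...
    (∀ m : ℕ, AreRepFamilies (canonRep m) (canonRepPerp m) ∧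
      ∀ W : Grass m, Nonempty (Reduction W) ∧ ∀ R : Reduction W, Nonempty R.Matching) ∧
    -- ... and it wins with probability `2^{-k}` for each `W`, hence is optimal
    (∀ (m : ℕ) (R : ∀ W : Grass m, Reduction W) (h : ∀ W : Grass m, (R W).Matching),
      IsStrategy (canonRep m) (canonRepPerp m) (bobStrategy R h) (charlieStrategy R h) ∧
      (∀ W : Grass m,
        winProbAt (canonRep m) (canonRepPerp m) (bobStrategy R h) (charlieStrategy R h) W =
          (1 / 2) ^ bobDim W) ∧
      winProb (canonRep m) (canonRepPerp m) (bobStrategy R h) (charlieStrategy R h) =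
        optimalValue m) := by
  exact ⟨fun m S T hST => isGreatest_optimalValue hST, isTheta_optimalValue,
    fun m => ⟨areRepFamilies_canon m, fun W => ⟨nonempty_reduction W, nonempty_matching⟩⟩,
    fun m R h => ⟨isStrategy_explicit R h, winProbAt_explicit R h,
      winProb_eq_optimalValue (winProbAt_explicit R h)⟩⟩
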